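/- Let $\mathbb F\in\{\mathbb R,\mathbb C\}$, $0<p\le 1$, let $\delta=(d_n)_{n\ge1}$ be a non-decreasing sequence of integers $d_n\ge 2$, and let $\eta=(N_k)_{k\ge1}$ be an unbounded sequence of positive integers. **The functions $\sigma,\Lambda,\Gamma$.** Put $\sigma(k)=2+\sum_{j=1}^{k-1}d_j$ for $k\ge1$, $\Lambda(n)=\sigma^{(n)}(1)$ ($n$-fold iteration, $\Lambda(0)=1$) and $\Gamma(m)=\max\{n\ge 0:\Lambda(n)\le m\}$ for $m\ge1$. **The basis.** In $\ell_p$ with unit vectors $(e_j)$ let $x_k=e_k+d_k^{-1/p}\sum_{j=\sigma(k)}^{\sigma(k+1)-1}e_j$ for $k\ge1$, and let $X_p^{(N)}(\delta)=\operatorname{span}(x_1,\dots,x_N)$ with the quasi-norm of $\ell_p$. Let $Y=\bigl(\bigoplus_{k=1}^\infty X_p^{(N_k)}(\delta)\bigr)_p$ be the $\ell_p$-sum, i.e. the sequences $f=(f_k)$ with $f_k\in X_p^{(N_k)}(\delta)$ and $\|f\|=(\sum_k\|f_k\|^p)^{1/p}<\infty$. Let $\mathcal Y=\mathcal Y_p[\delta,\eta]=(y_n)_{n\ge1}$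 be the sequence in $Y$ obtained by concatenating the finite sequences $(x_1,\dots,x_{N_k})$ of the summands, $k=1,2,\dots$ **Constants.** A *basis* of a quasi-Banach space $Y$ is a sequence $(y_n)$ with dense linear span, with $0<\inf_n\|y_n\|\le\sup_n\|y_n\|<\infty$, and with biorthogonal linear functionals $y_n^*$ such that $\sup_n\|y_n^*\|<\infty$ and such that only $f=0$ satisfies $y_n^*(f)=0$ for all $n$. Write $S_A(f)=\sum_{n\in A}y_n^*(f)\,y_n$ for finite $A\subseteq\mathbb N$. A finite set $A$ is a *greedy set* of $f$ if $|y_n^*(f)|\ge|y_k^*(f)|$ for all $n\in A$, $k\notin A$; let $\mathcal G_m(f)=S_A(f)$, where $A$ is a greedy set of $f$ with $|A|=m$, chosen arbitrarily if there are several. The basis is *almost greedy* if there is a constant $C$ with $\|f-S_A(f)\|\le C\|f-S_B(f)\|$ for all $f\in Y$, all greedy sets $A$ of $f$ and all $B$ with $|B|\le|A|$. Let $$k_m=\sup_{|A|\le m}\|S_A\|,\qquad \widetilde k_m=\sup\{\|S_A(f)\|: A\subseteq\mathbb N \text{ finite},\ f\in\operatorname{span}(y_1,\dots,y_m),\ \|f\|\le1\},$$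 and let the Lebesgue constant $\mathbf L_m$ be the least $C\in[0,\infty]$ with $\|f-\mathcal G_m(f)\|\le C\,\sigma_m(f)$ for all $f\in Y$, where $\sigma_m(f)$ is the infimum of $\|f-z\|$ over all linear combinations $z$ of $m$ vectors of the basis. **Theorem.** $Y$ is isomorphic to $\ell_p$, and $\mathcal Y$ is an almost greedy basis and a Schauder basis of $Y$; every $f\in Y$ has a greedy set of each cardinality $m\ge 0$. There are constants $0<c\le C<\infty$, independent of $m$ and of the choice of the greedy sets, such that for all $m\ge2$ $$c\,\Gamma(m)^{1/p}\le \mathbf L_m\le C\,\Gamma(m)^{1/p}\quad\text{and}\quad c\,\Gamma(m)^{1/p}\le k_m\le C\,\Gamma(m)^{1/p}.$$ If moreover there is a constant $K$ with $\sum_{j=1}^kN_j\le K\,N_{k+1}$ for all $k\ge1$, then there are constants $0<c'\le C'<\infty$ such that $c'\,\Gamma(m)^{1/p}\le\widetilde k_m\le C'\,\Gamma(m)^{1/p}$ for all $m\ge2$. -/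

import Mathlib

open scoped ENNReal NNReal Topology

noncomputable section

namespace LindenstraussBases

/-! ### `p`-normed spaces and their `ℓ_p`-sums -/

/-- The function `‖·‖` is a `p`-norm on the `𝕜`-vector space `E`, with `0 < p ≤ 1`. -/
class IsPNorm (p : ℝ) (𝕜 : Type*) (E : Type*) [RCLike 𝕜] [AddCommGroup E] [Module 𝕜 E]
    [Norm E] : Prop where
  pos : 0 < p
  le_one : p ≤ 1
  nonneg : ∀ x : E, 0 ≤ ‖x‖
  eq_zero : ∀ x : E, ‖x‖ = 0 → x = 0
  smul : ∀ (c : 𝕜) (x : E), ‖c • x‖ = ‖c‖ * ‖x‖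
  triangle : ∀ x y : E, ‖x + y‖ ^ p ≤ ‖x‖ ^ p + ‖y‖ ^ p

/-- The `ℓ_p`-sum `(⨁ₖ Eₖ)_p` of a sequence of `p`-normed spaces. -/
def lpSum (p : ℝ) (𝕜 : Type*) (E : ℕ → Type*) [RCLike 𝕜] [∀ k, AddCommGroup (E k)]
    [∀ k, Module 𝕜 (E k)] [∀ k, Norm (E k)] [hE : ∀ k, IsPNorm p 𝕜 (E k)] :
    Submodule 𝕜 (∀ k, E k) where
  carrier := {f | Summable fun k => ‖f k‖ ^ p}
  add_mem' {f g} hf hg :=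
    Summable.of_nonneg_of_le (fun k => Real.rpow_nonneg ((hE k).nonneg _) p)
      (fun k => (hE k).triangle (f k) (g k)) (Summable.add hf hg)
  zero_mem' := by
    have h0 : ∀ k, ‖(0 : E k)‖ = 0 := fun k => by
      simpa using (hE k).smul (0 : 𝕜) (0 : E k)
    simp [h0, Real.zero_rpow (hE 0).pos.ne']
  smul_mem' c f hf := by
    have h : (fun k => ‖(c • f) k‖ ^ p) = fun k => ‖c‖ ^ p * ‖f k‖ ^ p := by
      funext k
      rw [Pi.smul_apply, (hE k).smul, Real.mul_rpow (norm_nonneg c) ((hE k).nonneg _)]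
    show Summable fun k => ‖(c • f) k‖ ^ p
    rw [h]
    exact Summable.mul_left _ hf

/-- The `p`-norm `‖f‖ = (∑ₖ ‖fₖ‖ᵖ)^{1/p}` of the `ℓ_p`-sum. -/
instance lpSum.instNorm (p : ℝ) (𝕜 : Type*) (E : ℕ → Type*) [RCLike 𝕜]
    [∀ k, AddCommGroup (E k)] [∀ k, Module 𝕜 (E k)] [∀ k, Norm (E k)]
    [∀ k, IsPNorm p 𝕜 (E k)] : Norm (lpSum p 𝕜 E) :=
  ⟨fun f => (∑' k, ‖(f : ∀ k, E k) k‖ ^ p) ^ (1 / p)⟩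

/-- The sequence space `ℓ_p` over `𝕜`. -/
abbrev ell (𝕜 : Type*) [RCLike 𝕜] (p : ℝ) : Type _ := lp (fun _ : ℕ => 𝕜) (ENNReal.ofReal p)

instance ell.isPNorm (𝕜 : Type*) [RCLike 𝕜] (p : ℝ) [hp : Fact (0 < p)] [hp' : Fact (p ≤ 1)] :
    IsPNorm p 𝕜 (ell 𝕜 p) where
  pos := hp.out
  le_one := hp'.out
  nonneg := lp.norm_nonneg'
  eq_zero _ hx := lp.norm_eq_zero_iff.1 hx
  smul c x := lp.norm_const_smul (by simpa using hp.out) x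
  triangle x y := by
    have hpr : (ENNReal.ofReal p).toReal = p := ENNReal.toReal_ofReal hp.out.le
    have h0 : 0 < (ENNReal.ofReal p).toReal := hpr.symm ▸ hp.out
    have key := lp.norm_rpow_eq_tsum h0 (E := fun _ : ℕ => 𝕜)
    have hs := fun f : ell 𝕜 p => (lp.memℓp f).summable h0
    simp only [hpr] at key hs
    rw [key, key, key, ← (hs x).tsum_add (hs y)]
    refine (hs (x + y)).tsum_le_tsum (fun i => ?_) ((hs x).add (hs y))
    calc ‖(x + y) i‖ ^ p ≤ (‖x i‖ + ‖y i‖) ^ p :=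
          Real.rpow_le_rpow (norm_nonneg _) (norm_add_le _ _) hp.out.le
      _ ≤ ‖x i‖ ^ p + ‖y i‖ ^ p :=
          Real.rpow_add_le_add_rpow (norm_nonneg _) (norm_nonneg _) hp.out.le hp'.out

/-! ### The Lindenstrauss `p`-basis

Positions are counted from `0`: a sequence `(d₁, d₂, …)` is stored as `δ 0 = d₁, δ 1 = d₂, …`, and
the `k`-th unit vector, basis vector or summand (`k ≥ 1`) has index `k - 1`. -/

/-- The map `σ(k) = 2 + ∑_{j=1}^{k-1} d_j` (`k ≥ 1`), shifted to positions counted from `0`: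
`sigma δ i = σ(i + 1) - 1`. -/
def sigma (δ : ℕ → ℕ) (i : ℕ) : ℕ := 1 + ∑ j ∈ Finset.range i, δ j

/-- `Λ(n) = σ^{(n)}(1)`: `Λ(0) = 1`, `Λ(1) = 2`, `Λ(2) = 2 + d₁`, … -/
def Lambda (δ : ℕ → ℕ) (n : ℕ) : ℕ := (sigma δ)^[n] 0 + 1

/-- `Γ(m) = max {n ≥ 0 : Λ(n) ≤ m}` for `m ≥ 1`, the left inverse of `Λ`. (If all `d_j` are at
least `2` then `Λ(n) > n`, so nothing is lost by searching below `m`.) -/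
def Gamma (δ : ℕ → ℕ) (m : ℕ) : ℕ := Nat.findGreatest (fun n => Lambda δ n ≤ m) m

/-- The vector `x_k = e_k + d_k^{-1/p} ∑_{σ(k) ≤ j < σ(k+1)} e_j` of `ℓ_p`. -/
def linVec (𝕜 : Type*) [RCLike 𝕜] (p : ℝ) (δ : ℕ → ℕ) (i : ℕ) : ell 𝕜 p :=
  lp.single (ENNReal.ofReal p) i (1 : 𝕜) +
    (((δ i : ℝ) ^ (-(1 / p)) : ℝ) : 𝕜) •
      ∑ j ∈ Finset.Ico (sigma δ i) (sigma δ (i + 1)), lp.single (ENNReal.ofReal p) j (1 : 𝕜)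

/-- The space `X_p^{(N)}(δ) = [x_1, …, x_N] ⊆ ℓ_p`. -/
def linSpace (𝕜 : Type*) [RCLike 𝕜] (p : ℝ) (δ : ℕ → ℕ) (N : ℕ) : Submodule 𝕜 (ell 𝕜 p) :=
  Submodule.span 𝕜 (linVec 𝕜 p δ '' Set.Iio N)

instance linSpace.instNorm (𝕜 : Type*) [RCLike 𝕜] (p : ℝ) (δ : ℕ → ℕ) (N : ℕ) :
    Norm (linSpace 𝕜 p δ N) :=
  ⟨fun x => ‖(x : ell 𝕜 p)‖⟩

instance linSpace.isPNorm (𝕜 : Type*) [RCLike 𝕜] (p : ℝ) [hp : Fact (0 < p)]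
    [hp' : Fact (p ≤ 1)] (δ : ℕ → ℕ) (N : ℕ) : IsPNorm p 𝕜 (linSpace 𝕜 p δ N) where
  pos := hp.out
  le_one := hp'.out
  nonneg x := (ell.isPNorm 𝕜 p).nonneg (x : ell 𝕜 p)
  eq_zero x hx := Subtype.ext ((ell.isPNorm 𝕜 p).eq_zero (x : ell 𝕜 p) hx)
  smul c x := (ell.isPNorm 𝕜 p).smul c (x : ell 𝕜 p)
  triangle x y := (ell.isPNorm 𝕜 p).triangle (x : ell 𝕜 p) (y : ell 𝕜 p)

/-- The `i`-th vector of the basis `X_p^{(N)}(δ) = (x_1, …, x_N)`. -/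
def linBasis (𝕜 : Type*) [RCLike 𝕜] (p : ℝ) (δ : ℕ → ℕ) (N : ℕ) (i : Fin N) :
    linSpace 𝕜 p δ N :=
  ⟨linVec 𝕜 p δ i, Submodule.subset_span ⟨i, i.isLt, rfl⟩⟩

/-! ### The direct sum `Y_p[δ, η]` -/

/-- The space `(⨁ₖ X_p^{(N_k)}(δ))_p`, where `η = (N_k)ₖ`. -/
abbrev YSpace (𝕜 : Type*) [RCLike 𝕜] (p : ℝ) [Fact (0 < p)] [Fact (p ≤ 1)] (δ : ℕ → ℕ)
    (η : ℕ → ℕ+) : Type _ :=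
  lpSum p 𝕜 fun k => linSpace 𝕜 p δ (η k)

/-- The number of basis vectors in the blocks before the block `k`. -/
def blockStart (η : ℕ → ℕ+) (k : ℕ) : ℕ := ∑ j ∈ Finset.range k, (η j : ℕ)

/-- The block that contains the `n`-th vector of the concatenation of blocks of lengths
`N_1, N_2, …`: the largest `k` with `blockStart η k ≤ n`. -/
def block (η : ℕ → ℕ+) (n : ℕ) : ℕ := Nat.findGreatest (fun k => blockStart η k ≤ n) n

theorem lt_blockStart (η : ℕ → ℕ+) (n : ℕ) : n < blockStart η (block η n + 1) := by
  by_contra! h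
  have hid : ∀ k, k ≤ blockStart η k := fun k => by
    have := Finset.card_nsmul_le_sum (Finset.range k) (fun j => (η j : ℕ)) 1
      fun j _ => (η j).pos
    simpa [blockStart] using this
  have := Nat.le_findGreatest (P := fun k => blockStart η k ≤ n) ((hid _).trans h) h
  unfold block at this
  omega

theorem blockStart_le (η : ℕ → ℕ+) (n : ℕ) : blockStart η (block η n) ≤ n :=
  Nat.findGreatest_spec (P := fun k => blockStart η k ≤ n) (Nat.zero_le n) (by simp [blockStart])

/-- The position of the `n`-th vector of the concatenation inside its block. -/
def blockPos (η : ℕ → ℕ+) (n : ℕ) : Fin (η (block η n)) :=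
  ⟨n - blockStart η (block η n), by
    have h := lt_blockStart η n
    have h' := blockStart_le η n
    rw [blockStart, Finset.sum_range_succ, ← blockStart] at h
    omega⟩

/-- The canonical embedding of the summand `k` into an `ℓ_p`-sum. -/
def lpSum.single (p : ℝ) (𝕜 : Type*) (E : ℕ → Type*) [RCLike 𝕜] [∀ k, AddCommGroup (E k)]
    [∀ k, Module 𝕜 (E k)] [∀ k, Norm (E k)] [hE : ∀ k, IsPNorm p 𝕜 (E k)] (k : ℕ) (x : E k) :
    lpSum p 𝕜 E :=
  ⟨Pi.single k x, by
    refine summable_of_ne_finset_zero (s := {k}) fun j hj => ?_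
    have h0 : ‖(0 : E j)‖ = 0 := by simpa using (hE j).smul (0 : 𝕜) (0 : E j)
    rw [Pi.single_eq_of_ne (by simpa using hj), h0, Real.zero_rpow (hE j).pos.ne']⟩

/-- The basis `Y_p[δ, η] = (⨁ₖ X_p^{(N_k)}(δ))_p`: the bases of the summands, one after the
other. -/
def yBasis (𝕜 : Type*) [RCLike 𝕜] (p : ℝ) [Fact (0 < p)] [Fact (p ≤ 1)] (δ : ℕ → ℕ)
    (η : ℕ → ℕ+) (n : ℕ) : YSpace 𝕜 p δ η :=
  lpSum.single p 𝕜 (fun k => linSpace 𝕜 p δ (η k)) (block η n)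
    (linBasis 𝕜 p δ (η (block η n)) (blockPos η n))

/-! ### Bases in quasi-normed spaces -/

section Bases

/-- Two quasi-normed spaces are isomorphic: there is a linear bijection that is bounded together
with its inverse. -/
def Isomorphic (𝕜 Y Z : Type*) [RCLike 𝕜] [AddCommGroup Y] [Module 𝕜 Y] [Norm Y]
    [AddCommGroup Z] [Module 𝕜 Z] [Norm Z] : Prop :=
  ∃ T : Y ≃ₗ[𝕜] Z, ∃ C : ℝ, (∀ f, ‖T f‖ ≤ C * ‖f‖) ∧ ∀ g, ‖T.symm g‖ ≤ C * ‖g‖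

variable {𝕜 Y : Type*} [RCLike 𝕜] [AddCommGroup Y] [Module 𝕜 Y] [Norm Y]

/-- `y` is a semi-normalized fundamental M-bounded Markushevich basis of `Y` with coordinate
functionals `φ`. -/
structure IsMBasis (y : ℕ → Y) (φ : ℕ → Y →ₗ[𝕜] 𝕜) : Prop where
  biorthogonal : ∀ n k, φ n (y k) = if n = k then 1 else 0
  fundamental : ∀ f : Y, ∀ ε > 0, ∃ g ∈ Submodule.span 𝕜 (Set.range y), ‖f - g‖ < ε
  total : ∀ f : Y, (∀ n, φ n f = 0) → f = 0
  semi_normalized : ∃ a b : ℝ, 0 < a ∧ ∀ n, a ≤ ‖y n‖ ∧ ‖y n‖ ≤ b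
  bounded : ∃ C : ℝ, ∀ n f, ‖φ n f‖ ≤ C * ‖f‖

variable (𝕜) in
/-- `y` is a Schauder basis of `Y`: every vector has exactly one expansion `∑ₙ aₙ yₙ`. -/
def IsSchauderBasis (y : ℕ → Y) : Prop :=
  ∀ f : Y, ∃! a : ℕ → 𝕜,
    Filter.Tendsto (fun N => ‖f - ∑ n ∈ Finset.range N, a n • y n‖) Filter.atTop (𝓝 0)

/-- The coordinate projection `S_A(f) = ∑_{n ∈ A} φₙ(f) yₙ`. -/
def coordProj (y : ℕ → Y) (φ : ℕ → Y →ₗ[𝕜] 𝕜) (A : Finset ℕ) : Y →ₗ[𝕜] Y :=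
  ∑ n ∈ A, (φ n).smulRight (y n)

/-- `A` is a greedy set of `f`: its coefficients dominate the others in absolute value. -/
def IsGreedySet (φ : ℕ → Y →ₗ[𝕜] 𝕜) (f : Y) (A : Finset ℕ) : Prop :=
  ∀ n ∈ A, ∀ k ∉ A, ‖φ k f‖ ≤ ‖φ n f‖

/-- `y` is almost greedy: `‖f - 𝒢_m(f)‖ ≤ C ‖f - S_B(f)‖` whenever `|B| ≤ m`. -/
def IsAlmostGreedy (y : ℕ → Y) (φ : ℕ → Y →ₗ[𝕜] 𝕜) : Prop :=
  ∃ C : ℝ, ∀ (f : Y) (A B : Finset ℕ), IsGreedySet φ f A → B.card ≤ A.card →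
    ‖f - coordProj y φ A f‖ ≤ C * ‖f - coordProj y φ B f‖

/-- A way of choosing the greedy sums `𝒢_m(f) = S_A(f)`: a map `(m, f) ↦ A` such that `A` is a
greedy set of `f` of cardinality `m`. -/
def IsGreedyChoice (φ : ℕ → Y →ₗ[𝕜] 𝕜) (G : ℕ → Y → Finset ℕ) : Prop :=
  ∀ m f, (G m f).card = m ∧ IsGreedySet φ f (G m f)

/-- The quasi-norm of a linear operator, `∞` if the operator is unbounded. -/
def opQuasiNorm (T : Y →ₗ[𝕜] Y) : ℝ≥0∞ := ⨆ (f : Y) (_ : ‖f‖ ≤ 1), ENNReal.ofReal ‖T f‖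

/-- The conditionality constant `k_m = sup_{|A| ≤ m} ‖S_A‖`. -/
def condConst (y : ℕ → Y) (φ : ℕ → Y →ₗ[𝕜] 𝕜) (m : ℕ) : ℝ≥0∞ :=
  ⨆ (A : Finset ℕ) (_ : A.card ≤ m), opQuasiNorm (coordProj y φ A)

/-- The constant `k̃_m = sup {‖S_A(f)‖ : f ∈ [y_1, …, y_m], ‖f‖ ≤ 1}`. (For such `f` finite sets
`A` suffice.) -/
def condConstInit (y : ℕ → Y) (φ : ℕ → Y →ₗ[𝕜] 𝕜) (m : ℕ) : ℝ≥0∞ :=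
  ⨆ (A : Finset ℕ) (f : Y) (_ : f ∈ Submodule.span 𝕜 (y '' Set.Iio m)) (_ : ‖f‖ ≤ 1),
    ENNReal.ofReal ‖coordProj y φ A f‖

variable (𝕜) in
/-- The best `m`-term approximation error `σ_m(f)`. -/
def bestApprox (y : ℕ → Y) (m : ℕ) (f : Y) : ℝ≥0∞ :=
  ⨅ (A : Finset ℕ) (_ : A.card = m) (a : ℕ → 𝕜), ENNReal.ofReal ‖f - ∑ n ∈ A, a n • y n‖

/-- The Lebesgue constant `L_m` for the choice `G` of greedy sums: the least `C ∈ [0, ∞]` with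
`‖f - 𝒢_m(f)‖ ≤ C σ_m(f)` for all `f`. -/
def lebesgueConst (y : ℕ → Y) (φ : ℕ → Y →ₗ[𝕜] 𝕜) (G : ℕ → Y → Finset ℕ) (m : ℕ) : ℝ≥0∞ :=
  sInf {C : ℝ≥0∞ | ∀ f : Y,
    ENNReal.ofReal ‖f - coordProj y φ (G m f) f‖ ≤ C * bestApprox 𝕜 y m f}

end Bases

end LindenstraussBases

end

/-!
The combinatorics behind the theorem is a tree. Every position `j ≥ 1` has a parent, the `i` with
`sigma δ i ≤ j < sigma δ (i + 1)`, and a combination `∑ aᵢ xᵢ` has the coordinates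
`b_j = a_j + d_i^{-1/p} a_i` in `ℓ_p`, where `i` is the parent of `j`. With `s = |a|^p` and
`β = |b|^p` the norm is `(∑ β_j)^{1/p}`, and since `p ≤ 1` each `β_j` is at least the difference of
`s_j` and the share `s_i / d_i` that `j` receives when `i` splits its mass equally among its `d_i`
children (`IsMass`). All upper estimates are proved for such mass distributions.

* Cutting the tree at `N`, the mass that crosses the cut is at most the defect below it
  (`IsMass.sum_cut_le`). Hence partial sums are bounded, and the first `N` coordinates identify
  `X_p^{(N)}(δ)` with `ℓ_p^N` uniformly in `N`, so that `Y` is isomorphic to `ℓ_p`.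
* Applied to the `1`-Lipschitz function `Φ(x) = (x - θ)⁺`, the defect controls the sum of the losses
  `Φ(s) - d Φ(s / d)` (`IsMass.sum_excess_le`). This gives the weak-type estimate
  `τ · #{s ≥ τ} ≤ 2 ∑ β` (`IsMass.sum_large_le`) and the boundedness of greedy projections
  (`IsMass.sum_restrict_greedy_le`). The basis is therefore almost greedy, because the vectors
  `y_n` satisfy the upper `ℓ_p`-estimate trivially.
* For a density `c` on the tree, passing to the averages of `c` over the children of each node costs
  `∑ β` and reduces the total mass from `Λ(n + 1)` to `Λ(n)`, because `δ` is non-decreasing.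
  Iterating, `∑_{i ∈ A} s_i ≤ (n + 1) ∑ β` if `|A| < Λ(n)` (`IsMass.sum_finset_le`); this
  bounds `k_m`, and together with the weak-type estimate it bounds the Lebesgue constants.

For the lower estimates, the expansion of `e_0`, truncated to the first `n` levels, has norm at most
`2^{1/p}`, while each level carries the mass `1`. No coordinate cancels after restriction to the
positions of even depth, so this restriction has norm at least `n^{1/p}` (`le_norm_root_even`).
Placed in a block that is long enough, it bounds `k_m` and `k̃_m` from below. For the Lebesgue
constants, large coefficients on the positions of odd depth force the greedy algorithm to select
exactly those (`exists_bad_greedy`).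
-/

noncomputable section

namespace LindenstraussBases

/-! ### The tree of positions -/

/-- The parent of the position `j ≥ 1`: the `i` with `sigma δ i ≤ j < sigma δ (i + 1)`, that is, the
index of the vector `x_i` whose averaged part charges `e_j`. The root `0` is its own parent. -/
def parent (δ : ℕ → ℕ) (j : ℕ) : ℕ := Nat.findGreatest (fun i => sigma δ i ≤ j) j

/-- The number of positions of depth less than `n` in the tree, which is `Λ(n) - 1`. -/
def levelStart (δ : ℕ → ℕ) (n : ℕ) : ℕ := (sigma δ)^[n] 0

section Tree

variable {δ : ℕ → ℕ}

theorem sigma_zero (δ : ℕ → ℕ) : sigma δ 0 = 1 := by simp [sigma]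

theorem sigma_succ (δ : ℕ → ℕ) (i : ℕ) : sigma δ (i + 1) = sigma δ i + δ i := by
  simp [sigma, Finset.sum_range_succ, add_assoc]

theorem sigma_mono (δ : ℕ → ℕ) : Monotone (sigma δ) :=
  monotone_nat_of_le_succ fun i => by simp [sigma_succ]

theorem lt_sigma (hδ : ∀ n, 2 ≤ δ n) (i : ℕ) : i < sigma δ i := by
  induction i with
  | zero => simp [sigma_zero]
  | succ i ih => have := hδ i; rw [sigma_succ]; omega

theorem two_mul_lt_sigma (hδ : ∀ n, 2 ≤ δ n) (i : ℕ) : 2 * i < sigma δ i := by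
  induction i with
  | zero => simp [sigma_zero]
  | succ i ih => have := hδ i; rw [sigma_succ]; omega

theorem parent_zero (δ : ℕ → ℕ) : parent δ 0 = 0 := by simp [parent]

theorem parent_eq_iff (hδ : ∀ n, 2 ≤ δ n) {i j : ℕ} (hj : j ≠ 0) :
    parent δ j = i ↔ sigma δ i ≤ j ∧ j < sigma δ (i + 1) := by
  have hspec : sigma δ (parent δ j) ≤ j :=
    Nat.findGreatest_spec (P := fun i => sigma δ i ≤ j) (Nat.zero_le j)
      (by rw [sigma_zero]; omega)
  have hlt : j < sigma δ (parent δ j + 1) := by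
    by_contra! h
    have := Nat.le_findGreatest (P := fun i => sigma δ i ≤ j) ((lt_sigma hδ _).le.trans h) h
    unfold parent at this
    omega
  constructor
  · rintro rfl
    exact ⟨hspec, hlt⟩
  · rintro ⟨h1, h2⟩
    by_contra hne
    rcases lt_or_gt_of_ne hne with h | h
    · exact absurd (hlt.trans_le ((sigma_mono δ h).trans h1)) (lt_irrefl _)
    · exact absurd (h2.trans_le ((sigma_mono δ h).trans hspec)) (lt_irrefl _)

theorem parent_lt (hδ : ∀ n, 2 ≤ δ n) {j : ℕ} (hj : j ≠ 0) : parent δ j < j :=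
  (lt_sigma hδ _).trans_le ((parent_eq_iff hδ hj).1 rfl).1

theorem parent_le (hδ : ∀ n, 2 ≤ δ n) (j : ℕ) : parent δ j ≤ j := by
  rcases eq_or_ne j 0 with rfl | hj
  · simp [parent_zero]
  · exact (parent_lt hδ hj).le

theorem parent_lt_iff (hδ : ∀ n, 2 ≤ δ n) {j N : ℕ} (hj : j ≠ 0) :
    parent δ j < N ↔ j < sigma δ N := by
  have h := (parent_eq_iff hδ hj).1 rfl
  constructor
  · intro hlt
    exact h.2.trans_le (sigma_mono δ hlt)
  · intro hlt
    by_contra! hge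
    exact absurd (hlt.trans_le ((sigma_mono δ hge).trans h.1)) (lt_irrefl _)

/-- Summation over all positions below `sigma δ M` except the root, one family of siblings at a
time. -/
theorem sum_Ico_one_sigma (δ : ℕ → ℕ) (M : ℕ) (F : ℕ → ℝ) :
    ∑ j ∈ Finset.Ico 1 (sigma δ M), F j =
      ∑ i ∈ Finset.range M, ∑ j ∈ Finset.Ico (sigma δ i) (sigma δ (i + 1)), F j := by
  induction M with
  | zero => simp [sigma_zero]
  | succ M ih =>
    rw [Finset.sum_range_succ, ← ih, Finset.sum_Ico_consecutive]
    · rw [← sigma_zero δ]; exact sigma_mono δ (Nat.zero_le _)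
    · exact sigma_mono δ (Nat.le_succ _)

theorem sum_children_parent (hδ : ∀ n, 2 ≤ δ n) (i : ℕ) (F : ℕ → ℕ → ℝ) :
    ∑ j ∈ Finset.Ico (sigma δ i) (sigma δ (i + 1)), F (parent δ j) j =
      ∑ j ∈ Finset.Ico (sigma δ i) (sigma δ (i + 1)), F i j := by
  refine Finset.sum_congr rfl fun j hj => ?_
  rw [Finset.mem_Ico] at hj
  have hj0 : j ≠ 0 := by have := lt_sigma hδ i; omega
  rw [(parent_eq_iff hδ hj0).2 hj]

/-- Each `i < M` has `δ i` children, and these are the positions below `sigma δ M` other than the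
root. -/
theorem sum_parent (hδ : ∀ n, 2 ≤ δ n) (M : ℕ) (h : ℕ → ℝ) :
    ∑ j ∈ Finset.Ico 1 (sigma δ M), h (parent δ j) = ∑ i ∈ Finset.range M, δ i * h i := by
  rw [sum_Ico_one_sigma]
  refine Finset.sum_congr rfl fun i _ => ?_
  rw [sum_children_parent hδ i fun i _ => h i]
  simp [sigma_succ]

/-- Each node passes its mass to its children in equal parts. -/
theorem sum_parent_div (hδ : ∀ n, 2 ≤ δ n) (M : ℕ) (h : ℕ → ℝ) :
    ∑ j ∈ Finset.Ico 1 (sigma δ M), h (parent δ j) / δ (parent δ j) =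
      ∑ i ∈ Finset.range M, h i := by
  rw [sum_parent hδ M fun i => h i / δ i]
  refine Finset.sum_congr rfl fun i _ => ?_
  have : (δ i : ℝ) ≠ 0 := by have := hδ i; positivity
  field_simp

theorem sum_range_eq_add_Ico_one (F : ℕ → ℝ) {M : ℕ} (hM : 0 < M) :
    ∑ j ∈ Finset.range M, F j = F 0 + ∑ j ∈ Finset.Ico 1 M, F j := by
  rw [Finset.range_eq_Ico, Finset.sum_eq_sum_Ico_succ_bot hM]

theorem sigma_pos (δ : ℕ → ℕ) (M : ℕ) : 0 < sigma δ M := by simp [sigma]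

theorem levelStart_zero (δ : ℕ → ℕ) : levelStart δ 0 = 0 := rfl

theorem levelStart_succ (δ : ℕ → ℕ) (n : ℕ) :
    levelStart δ (n + 1) = sigma δ (levelStart δ n) := Function.iterate_succ_apply' _ _ _

theorem Lambda_eq (δ : ℕ → ℕ) (n : ℕ) : Lambda δ n = levelStart δ n + 1 := rfl

theorem le_levelStart (hδ : ∀ n, 2 ≤ δ n) (n : ℕ) : n ≤ levelStart δ n := by
  induction n with
  | zero => simp
  | succ n ih => have := lt_sigma hδ (levelStart δ n); rw [levelStart_succ]; omega

theorem two_pow_mul_levelStart_le (hδ : ∀ n, 2 ≤ δ n) (n q : ℕ) :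
    2 ^ q * levelStart δ n ≤ levelStart δ (n + q) := by
  induction q with
  | zero => simp
  | succ q ih =>
    have := two_mul_lt_sigma hδ (levelStart δ (n + q))
    rw [← add_assoc, levelStart_succ, pow_succ]
    linarith

theorem levelStart_Gamma_lt {m : ℕ} (hm : 2 ≤ m) :
    levelStart δ (Gamma δ m) < m := by
  have := Nat.findGreatest_spec (P := fun n => Lambda δ n ≤ m) (Nat.zero_le m)
    (by simp [Lambda_eq, levelStart_zero]; omega)
  exact this

theorem le_levelStart_Gamma_succ (hδ : ∀ n, 2 ≤ δ n) (m : ℕ) :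
    m ≤ levelStart δ (Gamma δ m + 1) := by
  by_contra! h
  have := Nat.le_findGreatest (P := fun n => Lambda δ n ≤ m)
    ((le_levelStart hδ _).trans h.le) (Nat.succ_le_of_lt h)
  unfold Gamma at this
  omega

theorem one_le_Gamma {m : ℕ} (hm : 2 ≤ m) : 1 ≤ Gamma δ m :=
  Nat.le_findGreatest (P := fun n => Lambda δ n ≤ m) (by omega)
    (by simpa [Lambda_eq, levelStart_succ, levelStart_zero, sigma_zero] using hm)

end Tree

/-! ### Mass distributions on the tree -/

/-- `s` is a nonnegative mass distribution on the tree with defect `β`: up to `β j`, the mass at `j`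
is the share that `j` receives when its parent splits its mass equally among its children. For a
vector with coefficients `a` and coordinates `b` in `ℓ_p` this holds with `s = |a|^p` and
`β = |b|^p`. -/
structure IsMass (δ : ℕ → ℕ) (s β : ℕ → ℝ) : Prop where
  nonneg : ∀ j, 0 ≤ s j
  root : s 0 = β 0
  step : ∀ j, j ≠ 0 → |s j - s (parent δ j) / δ (parent δ j)| ≤ β j

namespace IsMass

variable {δ : ℕ → ℕ} {s β : ℕ → ℝ}

theorem defect_nonneg (h : IsMass δ s β) (j : ℕ) : 0 ≤ β j := by
  rcases eq_or_ne j 0 with rfl | hj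
  · rw [← h.root]; exact h.nonneg 0
  · exact (abs_nonneg _).trans (h.step j hj)

theorem le_add (h : IsMass δ s β) {j : ℕ} (hj : j ≠ 0) :
    s j ≤ β j + s (parent δ j) / δ (parent δ j) := by
  have := (abs_le.1 (h.step j hj)).2
  linarith

theorem parent_le_add (h : IsMass δ s β) {j : ℕ} (hj : j ≠ 0) :
    s (parent δ j) / δ (parent δ j) ≤ β j + s j := by
  have := (abs_le.1 (h.step j hj)).1
  linarith

theorem sum_le_sum (h : IsMass δ s β) {A B : Finset ℕ} (hAB : A ⊆ B) :
    ∑ j ∈ A, β j ≤ ∑ j ∈ B, β j :=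
  Finset.sum_le_sum_of_subset_of_nonneg hAB fun j _ _ => h.defect_nonneg j

theorem le_sum (hδ : ∀ n, 2 ≤ δ n) (h : IsMass δ s β) (j : ℕ) :
    s j ≤ ∑ i ∈ Finset.range (j + 1), β i := by
  induction j using Nat.strong_induction_on with
  | _ j ih =>
    rw [Finset.sum_range_succ]
    rcases eq_or_ne j 0 with rfl | hj
    · simp [h.root]
    · have hp := parent_lt hδ hj
      have h1 := ih _ hp
      have h2 := h.sum_le_sum (Finset.range_mono (Nat.succ_le_of_lt hp))
      have h3 : s (parent δ j) / δ (parent δ j) ≤ s (parent δ j) := by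
        refine div_le_self (h.nonneg _) ?_
        have := hδ (parent δ j)
        exact_mod_cast (by omega : 1 ≤ δ (parent δ j))
      have := h.le_add hj
      have h4 : ∑ i ∈ Finset.range (parent δ j).succ, β i ≤ ∑ i ∈ Finset.range j, β i := h2
      linarith

/-- Cutting the tree at `M`, the mass that flows across the cut is at most the defect below it. -/
theorem sum_cut_le (hδ : ∀ n, 2 ≤ δ n) (h : IsMass δ s β) {M : ℕ} (hM : 0 < M) :
    ∑ j ∈ Finset.Ico M (sigma δ M), s (parent δ j) / δ (parent δ j) ≤
      ∑ j ∈ Finset.range M, β j := by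
  have h1 := sum_parent_div hδ M s
  rw [← Finset.sum_Ico_consecutive _ hM (lt_sigma hδ M).le] at h1
  rw [sum_range_eq_add_Ico_one _ hM] at h1 ⊢
  have h2 : ∑ j ∈ Finset.Ico 1 M, s j ≤
      ∑ j ∈ Finset.Ico 1 M, (β j + s (parent δ j) / δ (parent δ j)) :=
    Finset.sum_le_sum fun j hj => h.le_add (by have := (Finset.mem_Ico.1 hj).1; omega)
  rw [Finset.sum_add_distrib] at h2
  rw [← h.root]
  linarith

/-- The potential method: a `1`-Lipschitz function `Φ` turns the defect into a sum over nodes of the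
loss of `Φ` when a node splits its mass. -/
theorem sum_potential_le (hδ : ∀ n, 2 ≤ δ n) (h : IsMass δ s β) {N : ℕ}
    (hN : ∀ j, N ≤ j → s j = 0) (Φ : ℝ → ℝ) (hΦ : ∀ x y, |Φ x - Φ y| ≤ |x - y|) (hΦ0 : Φ 0 = 0) :
    ∑ i ∈ Finset.range N, (Φ (s i) - δ i * Φ (s i / δ i)) ≤
      ∑ j ∈ Finset.range (sigma δ N), β j := by
  have h1 : ∑ i ∈ Finset.range N, Φ (s i) = ∑ j ∈ Finset.range (sigma δ N), Φ (s j) := by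
    refine Finset.sum_subset (Finset.range_mono (lt_sigma hδ N).le) fun j _ hj => ?_
    rw [hN j (by simpa using hj), hΦ0]
  have h2 := sum_parent hδ N fun i => Φ (s i / δ i)
  rw [Finset.sum_sub_distrib, h1, ← h2, sum_range_eq_add_Ico_one _ (sigma_pos δ N),
    sum_range_eq_add_Ico_one _ (sigma_pos δ N), add_sub_assoc, ← Finset.sum_sub_distrib]
  refine add_le_add ?_ (Finset.sum_le_sum fun j hj => ?_)
  · have := (le_abs_self _).trans (hΦ (s 0) 0)
    rw [hΦ0, sub_zero, sub_zero, abs_of_nonneg (h.nonneg 0)] at this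
    exact this.trans h.root.le
  · exact (le_abs_self _).trans ((hΦ _ _).trans
      (h.step j (by have := (Finset.mem_Ico.1 hj).1; omega)))

/-- The potential method with `Φ(x) = (x - θ)⁺`, for which `d Φ(x / d) = (x - d θ)⁺`. -/
theorem sum_excess_le (hδ : ∀ n, 2 ≤ δ n) (h : IsMass δ s β) {N : ℕ}
    (hN : ∀ j, N ≤ j → s j = 0) {θ : ℝ} (hθ : 0 ≤ θ) :
    ∑ i ∈ Finset.range N, (max (s i - θ) 0 - max (s i - δ i * θ) 0) ≤
      ∑ j ∈ Finset.range (sigma δ N), β j := by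
  have := h.sum_potential_le hδ hN (fun x => max (x - θ) 0)
    (fun x y => by
      have := abs_max_sub_max_le_abs (x - θ) (y - θ) 0
      simpa using this) (by simpa using hθ)
  refine le_trans (le_of_eq (Finset.sum_congr rfl fun i _ => ?_)) this
  have hd : (0 : ℝ) < δ i := by have := hδ i; positivity
  rw [mul_max_of_nonneg _ _ hd.le, mul_zero, mul_sub, mul_div_cancel₀ _ hd.ne']

theorem excess_nonneg {x θ d : ℝ} (hθ : 0 ≤ θ) (hd : 2 ≤ d) :
    0 ≤ max (x - θ) 0 - max (x - d * θ) 0 := by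
  have : x - d * θ ≤ x - θ := by nlinarith
  exact sub_nonneg.2 (max_le_max this le_rfl)

theorem le_excess {x θ d : ℝ} (hθ : 0 ≤ θ) (hd : 2 ≤ d) (hx : 2 * θ ≤ x) :
    θ ≤ max (x - θ) 0 - max (x - d * θ) 0 := by
  rw [max_eq_left (by linarith)]
  rcases max_cases (x - d * θ) 0 with ⟨h, _⟩ | ⟨h, _⟩ <;> rw [h] <;> nlinarith

theorem le_excess_add {x θ d : ℝ} (hθ : 0 ≤ θ) (hd : 2 ≤ d) (h1 : θ ≤ x) (h2 : x ≤ 2 * (d * θ)) :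
    x ≤ 4 * (max (x - θ) 0 - max (x - d * θ) 0) + θ := by
  rw [max_eq_left (by linarith)]
  rcases max_cases (x - d * θ) 0 with ⟨h, _⟩ | ⟨h, _⟩ <;> rw [h] <;> nlinarith

/-- The weak-type estimate: the nodes of mass at least `τ` are few. With `θ = τ / 2` each of them
loses at least `θ` of the potential `(x - θ)⁺`. -/
theorem sum_large_le (hδ : ∀ n, 2 ≤ δ n) (h : IsMass δ s β) {N : ℕ}
    (hN : ∀ j, N ≤ j → s j = 0) {τ : ℝ} (hτ : 0 ≤ τ) {A : Finset ℕ}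
    (hA : A ⊆ Finset.range N) (hs : ∀ i ∈ A, τ ≤ s i) :
    ∑ _i ∈ A, τ ≤ 2 * ∑ j ∈ Finset.range (sigma δ N), β j := by
  have hd : ∀ i, (2 : ℝ) ≤ δ i := fun i => by exact_mod_cast hδ i
  have h1 := h.sum_excess_le hδ hN (div_nonneg hτ zero_le_two)
  have h2 : ∑ _i ∈ A, τ / 2 ≤ ∑ i ∈ A, (max (s i - τ / 2) 0 - max (s i - δ i * (τ / 2)) 0) :=
    Finset.sum_le_sum fun i hi => le_excess (by linarith) (hd i) (by linarith [hs i hi])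
  have h3 := Finset.sum_le_sum_of_subset_of_nonneg hA
    (f := fun i => max (s i - τ / 2) 0 - max (s i - δ i * (τ / 2)) 0)
    fun i _ _ => excess_nonneg (by linarith) (hd i)
  rw [← Finset.sum_div] at h2
  linarith

/-- Restricting a vector to a greedy set `A` (with threshold `τ`) costs at most a constant factor.
Here `γ` stands for the `p`-th powers of the coordinates of the restriction. An edge from a parent
in `A` to a child outside `A` is charged to the defect of the child if the parent has mass more than
`2 δ τ`, and to the excess `(s - τ)⁺` lost at the parent otherwise. -/
theorem sum_restrict_greedy_le (hδ : ∀ n, 2 ≤ δ n) (h : IsMass δ s β) {N : ℕ}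
    (hN : ∀ j, N ≤ j → s j = 0) {τ : ℝ} (hτ : 0 ≤ τ) {A : Finset ℕ}
    (hA : A ⊆ Finset.range N) (hs : ∀ i ∈ A, τ ≤ s i) (hs' : ∀ i ∉ A, s i ≤ τ) {γ : ℕ → ℝ}
    (hγ0 : γ 0 ≤ β 0)
    (hγ : ∀ j, j ≠ 0 → γ j ≤ if j ∈ A then (if parent δ j ∈ A then β j else s j)
      else (if parent δ j ∈ A then s (parent δ j) / δ (parent δ j) else 0)) :
    ∑ j ∈ Finset.range (sigma δ N), γ j ≤ 10 * ∑ j ∈ Finset.range (sigma δ N), β j := by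
  have hd : ∀ i, (2 : ℝ) ≤ δ i := fun i => by exact_mod_cast hδ i
  have hd0 : ∀ i, (0 : ℝ) < δ i := fun i => by linarith [hd i]
  set Ψ : ℕ → ℝ := fun i => max (s i - τ) 0 - max (s i - δ i * τ) 0 with hΨ
  have hΨ0 : ∀ i, 0 ≤ Ψ i := fun i => excess_nonneg hτ (hd i)
  set μ : ℕ → ℝ := fun i => if i ∈ A then 4 * Ψ i + τ else 0 with hμ
  have hμ0 : ∀ i, 0 ≤ μ i := fun i => by
    simp only [hμ]; split_ifs
    · linarith [hΨ0 i]
    · exact le_rfl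
  have key : ∀ j ∈ Finset.Ico 1 (sigma δ N), γ j ≤
      2 * β j + (if j ∈ A then τ else 0) + μ (parent δ j) / δ (parent δ j) := by
    intro j hj
    have hj0 : j ≠ 0 := by have := (Finset.mem_Ico.1 hj).1; omega
    have hβ := h.defect_nonneg j
    have hm := div_nonneg (hμ0 (parent δ j)) (hd0 (parent δ j)).le
    refine (hγ j hj0).trans ?_
    by_cases h1 : j ∈ A <;> by_cases h2 : parent δ j ∈ A <;> simp only [h1, h2, if_true, if_false]
    · linarith
    · have h3 := h.le_add hj0
      have h4 : s (parent δ j) / δ (parent δ j) ≤ τ := by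
        rw [div_le_iff₀ (hd0 _)]
        nlinarith [hs' _ h2, hd (parent δ j)]
      linarith
    · by_cases h5 : s (parent δ j) ≤ 2 * (δ (parent δ j) * τ)
      · have h6 := le_excess_add hτ (hd _) (hs _ h2) h5
        have h7 : s (parent δ j) / δ (parent δ j) ≤ μ (parent δ j) / δ (parent δ j) := by
          refine div_le_div_of_nonneg_right ?_ (hd0 _).le
          simp only [hμ, h2, if_true, hΨ]
          exact h6
        linarith
      · have h6 : 2 * τ ≤ s (parent δ j) / δ (parent δ j) := by
          rw [le_div_iff₀ (hd0 _)]
          push Not at h5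
          linarith
        have h7 := h.parent_le_add hj0
        have h8 := hs' _ h1
        linarith
    · linarith
  have h1 := Finset.sum_le_sum key
  rw [Finset.sum_add_distrib, Finset.sum_add_distrib, ← Finset.mul_sum, sum_parent_div hδ N μ] at h1
  have hW := h.sum_large_le hδ hN hτ hA hs
  have h2 : ∑ j ∈ Finset.Ico 1 (sigma δ N), (if j ∈ A then τ else 0) ≤ ∑ _i ∈ A, τ := by
    rw [← Finset.sum_filter]
    refine Finset.sum_le_sum_of_subset_of_nonneg ?_ fun _ _ _ => hτ
    intro j hj
    exact (Finset.mem_filter.1 hj).2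
  have h3 : ∑ i ∈ Finset.range N, μ i = ∑ i ∈ A, (4 * Ψ i + τ) := by
    rw [← Finset.sum_filter, Finset.filter_mem_eq_inter, Finset.inter_eq_right.2 hA]
  have h4 : ∑ i ∈ A, Ψ i ≤ ∑ j ∈ Finset.range (sigma δ N), β j :=
    (Finset.sum_le_sum_of_subset_of_nonneg hA fun i _ _ => hΨ0 i).trans
      (h.sum_excess_le hδ hN hτ)
  rw [h3, Finset.sum_add_distrib, ← Finset.mul_sum] at h1
  have h5 := sum_range_eq_add_Ico_one γ (sigma_pos δ N)
  have h6 := sum_range_eq_add_Ico_one β (sigma_pos δ N)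
  have h7 := h.defect_nonneg 0
  linarith

/-- Among all densities `c ≤ 1` with a given weighted sum `∑ δᵢ cᵢ`, where `δ` is non-decreasing, an
initial segment has the largest total mass. -/
theorem sum_le_of_weighted_sum_le (hδ : ∀ n, 2 ≤ δ n) (hmono : Monotone δ) {c : ℕ → ℝ}
    (hc0 : ∀ i, 0 ≤ c i) (hc1 : ∀ i, c i ≤ 1) {M q : ℕ}
    (h : ∑ i ∈ Finset.range M, δ i * c i ≤ ∑ i ∈ Finset.range q, (δ i : ℝ) + 2) :
    ∑ i ∈ Finset.range M, c i ≤ q + 1 := by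
  rcases le_total M q with hMq | hqM
  · calc ∑ i ∈ Finset.range M, c i ≤ ∑ _i ∈ Finset.range M, (1 : ℝ) :=
          Finset.sum_le_sum fun i _ => hc1 i
      _ ≤ q + 1 := by
          have : (M : ℝ) ≤ q := by exact_mod_cast hMq
          simp; linarith
  · set u : ℕ → ℝ := fun i => if i ∈ Finset.range q then 1 else 0 with hu
    have hsub : Finset.range q ⊆ Finset.range M := Finset.range_mono hqM
    have hu1 : ∀ g : ℕ → ℝ, ∑ i ∈ Finset.range M, g i * u i = ∑ i ∈ Finset.range q, g i := by
      intro g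
      simp only [hu, mul_ite, mul_one, mul_zero]
      rw [← Finset.sum_filter, Finset.filter_mem_eq_inter, Finset.inter_eq_right.2 hsub]
    -- `c - u` changes sign from `≤ 0` to `≥ 0` at `q`, and so does `δ i - δ q`.
    have key : ∑ i ∈ Finset.range M, (δ q : ℝ) * (c i - u i) ≤
        ∑ i ∈ Finset.range M, (δ i : ℝ) * (c i - u i) := by
      refine Finset.sum_le_sum fun i _ => ?_
      by_cases hi : i < q
      · have h1 : (δ i : ℝ) ≤ δ q := by exact_mod_cast hmono hi.le
        have h2 : u i = 1 := by simp [hu, hi]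
        rw [h2]
        nlinarith [hc1 i]
      · have h1 : (δ q : ℝ) ≤ δ i := by exact_mod_cast hmono (not_lt.1 hi)
        have h2 : u i = 0 := by simp [hu, hi]
        rw [h2]
        nlinarith [hc0 i]
    have h3 := hu1 fun i => (δ i : ℝ)
    have h4 := hu1 fun _ => 1
    simp only [one_mul, Finset.sum_const, Finset.card_range, nsmul_eq_mul, mul_one] at h4
    rw [← Finset.mul_sum] at key
    simp only [mul_sub, Finset.sum_sub_distrib] at key
    rw [h3, h4] at key
    have hd : (2 : ℝ) ≤ δ q := by exact_mod_cast hδ q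
    by_contra! hcon
    nlinarith

/-- If `c` is a density on the tree of total mass at most `levelStart δ n + 1`, then the `c`-weighted
sum of `s` is at most `n + 1` times the defect. The induction passes from `c` to its averages over
the children of a node. The weighted sum `∑ δᵢ c'ᵢ` is at most `levelStart δ (n + 1) + 1`, which
exceeds `∑ δᵢ` over `i < levelStart δ n` by `2`; as `δ ≥ 2`, this excess adds at most `1` to the mass
of the averages `c'`, so the bound keeps its form. -/
theorem sum_mul_le (hδ : ∀ n, 2 ≤ δ n) (hmono : Monotone δ) (h : IsMass δ s β) {E : ℝ}
    (hE : ∀ K, ∑ j ∈ Finset.range K, β j ≤ E) (n : ℕ) {c : ℕ → ℝ} (hc0 : ∀ i, 0 ≤ c i)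
    (hc1 : ∀ i, c i ≤ 1) {M : ℕ} (hM : ∀ i, M ≤ i → c i = 0)
    (hc : ∑ i ∈ Finset.range M, c i ≤ levelStart δ n + 1) :
    ∑ i ∈ Finset.range M, c i * s i ≤ (n + 1) * E := by
  have hE0 : 0 ≤ E := by simpa using hE 0
  induction n generalizing c with
  | zero =>
    rw [levelStart_zero, Nat.cast_zero, zero_add] at hc
    calc ∑ i ∈ Finset.range M, c i * s i ≤ ∑ i ∈ Finset.range M, c i * E :=
          Finset.sum_le_sum fun i _ =>
            mul_le_mul_of_nonneg_left ((h.le_sum hδ i).trans (hE _)) (hc0 i)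
      _ = (∑ i ∈ Finset.range M, c i) * E := by rw [Finset.sum_mul]
      _ ≤ 1 * E := mul_le_mul_of_nonneg_right hc hE0
      _ = _ := by simp
  | succ n ih =>
    have hd0 : ∀ i, (0 : ℝ) < δ i := fun i => by have := hδ i; positivity
    set c' : ℕ → ℝ :=
      fun i => (∑ j ∈ Finset.Ico (sigma δ i) (sigma δ (i + 1)), c j) / δ i with hc'
    have hδc' : ∀ i, δ i * c' i = ∑ j ∈ Finset.Ico (sigma δ i) (sigma δ (i + 1)), c j := fun i => by
      simp only [hc']; rw [mul_div_cancel₀ _ (hd0 i).ne']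
    have hc'0 : ∀ i, 0 ≤ c' i := fun i =>
      div_nonneg (Finset.sum_nonneg fun j _ => hc0 j) (hd0 i).le
    have hc'1 : ∀ i, c' i ≤ 1 := fun i => by
      rw [div_le_one (hd0 i)]
      refine (Finset.sum_le_sum fun j _ => hc1 j).trans ?_
      simp [sigma_succ]
    have hM' : ∀ i, M ≤ i → c' i = 0 := fun i hi => by
      simp only [hc']
      rw [Finset.sum_eq_zero, zero_div]
      intro j hj
      have := (Finset.mem_Ico.1 hj).1
      have := lt_sigma hδ i
      exact hM j (by omega)
    have hext : ∀ g : ℕ → ℝ, ∑ i ∈ Finset.range M, c i * g i =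
        c 0 * g 0 + ∑ j ∈ Finset.Ico 1 (sigma δ M), c j * g j := fun g => by
      rw [← sum_range_eq_add_Ico_one (fun j => c j * g j) (sigma_pos δ M)]
      refine Finset.sum_subset (Finset.range_mono (lt_sigma hδ M).le) fun j _ hj => ?_
      rw [hM j (by simpa using hj), zero_mul]
    have hsum : ∑ i ∈ Finset.range M, c' i ≤ levelStart δ n + 1 := by
      refine sum_le_of_weighted_sum_le hδ hmono hc'0 hc'1 ?_
      have h1 := hext fun _ => 1
      simp only [mul_one] at h1
      rw [sum_Ico_one_sigma] at h1
      simp only [hδc']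
      have h2 : (levelStart δ (n + 1) : ℝ) = 1 + ∑ i ∈ Finset.range (levelStart δ n), (δ i : ℝ) := by
        rw [levelStart_succ, sigma]; push_cast; rfl
      linarith [hc0 0]
    have h1 := ih hc'0 hc'1 hM' hsum
    have h2 : ∑ j ∈ Finset.Ico 1 (sigma δ M), c j * s j ≤ ∑ j ∈ Finset.Ico 1 (sigma δ M), β j +
        ∑ i ∈ Finset.range M, c' i * s i := by
      have h3 : ∑ i ∈ Finset.range M, c' i * s i =
          ∑ j ∈ Finset.Ico 1 (sigma δ M), c j * (s (parent δ j) / δ (parent δ j)) := by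
        rw [sum_Ico_one_sigma]
        refine Finset.sum_congr rfl fun i _ => ?_
        rw [sum_children_parent hδ i fun i j => c j * (s i / δ i), ← Finset.sum_mul]
        simp only [hc']
        ring
      rw [h3, ← Finset.sum_add_distrib]
      refine Finset.sum_le_sum fun j hj => ?_
      have h4 := h.le_add (j := j) (by have := (Finset.mem_Ico.1 hj).1; omega)
      have h5 := h.defect_nonneg j
      nlinarith [hc0 j, hc1 j, mul_le_mul_of_nonneg_left h4 (hc0 j)]
    have h6 := hE (sigma δ M)
    rw [sum_range_eq_add_Ico_one _ (sigma_pos δ M)] at h6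
    have h7 : c 0 * s 0 ≤ β 0 := by
      rw [h.root]
      nlinarith [hc0 0, hc1 0, h.defect_nonneg 0]
    rw [hext]
    push_cast
    linarith

theorem sum_finset_le (hδ : ∀ n, 2 ≤ δ n) (hmono : Monotone δ) (h : IsMass δ s β) {E : ℝ}
    (hE : ∀ K, ∑ j ∈ Finset.range K, β j ≤ E) {n : ℕ} {A : Finset ℕ}
    (hA : A.card ≤ levelStart δ n) : ∑ i ∈ A, s i ≤ (n + 1) * E := by
  obtain ⟨M, hM⟩ := A.exists_nat_subset_range
  have hext : ∀ g : ℕ → ℝ, ∑ i ∈ Finset.range M, (if i ∈ A then 1 else 0) * g i =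
      ∑ i ∈ A, g i := fun g => by
    simp only [ite_mul, one_mul, zero_mul]
    rw [← Finset.sum_filter, Finset.filter_mem_eq_inter, Finset.inter_eq_right.2 hM]
  rw [← hext]
  refine h.sum_mul_le hδ hmono hE n (fun i => by split_ifs <;> norm_num)
    (fun i => by split_ifs <;> norm_num) (fun i hi => if_neg fun hiA => ?_) ?_
  · have := Finset.mem_range.1 (hM hiA); omega
  · have h1 := hext fun _ => 1
    simp only [mul_one, Finset.sum_const, nsmul_eq_mul] at h1
    rw [h1]
    have : (A.card : ℝ) ≤ levelStart δ n := by exact_mod_cast hA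
    linarith

/-- If all the mass starts at the root and none is lost, every level carries the same mass. -/
theorem sum_range_levelStart (hδ : ∀ n, 2 ≤ δ n) (h0 : s 0 = 1)
    (h : ∀ j, j ≠ 0 → s j = s (parent δ j) / δ (parent δ j)) (n : ℕ) :
    ∑ j ∈ Finset.range (levelStart δ n), s j = n := by
  induction n with
  | zero => simp [levelStart_zero]
  | succ n ih =>
    rw [levelStart_succ, sum_range_eq_add_Ico_one _ (sigma_pos δ _), h0]
    have h1 : ∑ j ∈ Finset.Ico 1 (sigma δ (levelStart δ n)), s j =
        ∑ j ∈ Finset.Ico 1 (sigma δ (levelStart δ n)), s (parent δ j) / δ (parent δ j) :=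
      Finset.sum_congr rfl fun j hj => h j (by have := (Finset.mem_Ico.1 hj).1; omega)
    rw [h1, sum_parent_div hδ, ih]
    push_cast
    ring

end IsMass

/-! ### Coefficients and coordinates of vectors of `ℓ_p` -/

section Coordinates

variable {𝕜 : Type*} [RCLike 𝕜]

/-- The weight `d_i^{-1/p}` of the averaged part of `x_i`. -/
def weight (p : ℝ) (δ : ℕ → ℕ) (i : ℕ) : ℝ := (δ i : ℝ) ^ (-(1 / p))

variable (𝕜) in
/-- The coordinates in `ℓ_p` of the formal combination `∑ᵢ aᵢ xᵢ`. -/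
def coordMap (p : ℝ) (δ : ℕ → ℕ) : (ℕ → 𝕜) →ₗ[𝕜] (ℕ → 𝕜) where
  toFun a j := a j + if j = 0 then 0 else (weight p δ (parent δ j) : 𝕜) * a (parent δ j)
  map_add' a b := by
    funext j
    simp only [Pi.add_apply]
    split_ifs <;> ring
  map_smul' c a := by
    funext j
    simp only [Pi.smul_apply, smul_eq_mul, RingHom.id_apply]
    split_ifs <;> ring

variable (𝕜) in
/-- The `j`-th coefficient with respect to `(x_i)` as a linear functional of the coordinates. The
test `parent δ j < j` fails for the root only. -/
def coef (p : ℝ) (δ : ℕ → ℕ) (j : ℕ) : (ℕ → 𝕜) →ₗ[𝕜] 𝕜 :=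
  if _h : parent δ j < j then
    LinearMap.proj j - (weight p δ (parent δ j) : 𝕜) • coef p δ (parent δ j)
  else LinearMap.proj j

variable {p : ℝ} {δ : ℕ → ℕ}

theorem coef_zero (x : ℕ → 𝕜) : coef 𝕜 p δ 0 x = x 0 := by
  rw [coef]; simp

theorem coef_of_ne_zero (hδ : ∀ n, 2 ≤ δ n) {j : ℕ} (hj : j ≠ 0) (x : ℕ → 𝕜) :
    coef 𝕜 p δ j x = x j - (weight p δ (parent δ j) : 𝕜) * coef 𝕜 p δ (parent δ j) x := by
  rw [coef, dif_pos (parent_lt hδ hj)]; rfl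

theorem coordMap_zero (a : ℕ → 𝕜) : coordMap 𝕜 p δ a 0 = a 0 := by simp [coordMap]

theorem coordMap_of_ne_zero {j : ℕ} (hj : j ≠ 0) (a : ℕ → 𝕜) :
    coordMap 𝕜 p δ a j = a j + (weight p δ (parent δ j) : 𝕜) * a (parent δ j) := by
  simp [coordMap, hj]

theorem coordMap_coef (hδ : ∀ n, 2 ≤ δ n) (x : ℕ → 𝕜) :
    coordMap 𝕜 p δ (fun i => coef 𝕜 p δ i x) = x := by
  funext j
  rcases eq_or_ne j 0 with rfl | hj
  · rw [coordMap_zero, coef_zero]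
  · rw [coordMap_of_ne_zero hj, coef_of_ne_zero hδ hj]; ring

/-- The coefficients below `N` determine the coordinates below `N`. -/
theorem apply_congr_of_coef (hδ : ∀ n, 2 ≤ δ n) {N : ℕ} {x y : ℕ → 𝕜}
    (h : ∀ j < N, coef 𝕜 p δ j x = coef 𝕜 p δ j y) : ∀ j < N, x j = y j := by
  intro j hj
  rw [← coordMap_coef (p := p) hδ x, ← coordMap_coef (p := p) hδ y]
  rcases eq_or_ne j 0 with rfl | hj0
  · rw [coordMap_zero, coordMap_zero, h 0 hj]
  · rw [coordMap_of_ne_zero hj0, coordMap_of_ne_zero hj0, h j hj,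
      h _ ((parent_lt hδ hj0).trans hj)]

theorem coef_coordMap (hδ : ∀ n, 2 ≤ δ n) (a : ℕ → 𝕜) (j : ℕ) :
    coef 𝕜 p δ j (coordMap 𝕜 p δ a) = a j := by
  induction j using Nat.strong_induction_on with
  | _ j ih =>
    rcases eq_or_ne j 0 with rfl | hj
    · rw [coef_zero, coordMap_zero]
    · rw [coef_of_ne_zero hδ hj, ih _ (parent_lt hδ hj), coordMap_of_ne_zero hj]; ring

theorem weight_nonneg (p : ℝ) (δ : ℕ → ℕ) (i : ℕ) : 0 ≤ weight p δ i :=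
  Real.rpow_nonneg (Nat.cast_nonneg _) _

theorem weight_rpow (hp : 0 < p) (i : ℕ) : weight p δ i ^ p = (δ i : ℝ)⁻¹ := by
  rw [weight, ← Real.rpow_mul (Nat.cast_nonneg _), neg_mul, one_div, inv_mul_cancel₀ hp.ne',
    Real.rpow_neg_one]

theorem norm_weight_mul_rpow (hp : 0 < p) (i : ℕ) (c : 𝕜) :
    ‖(weight p δ i : 𝕜) * c‖ ^ p = ‖c‖ ^ p / δ i := by
  rw [norm_mul, RCLike.norm_ofReal, abs_of_nonneg (weight_nonneg p δ i),
    Real.mul_rpow (weight_nonneg p δ i) (norm_nonneg c), weight_rpow hp, div_eq_inv_mul]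

theorem norm_add_rpow_le (hp : 0 < p) (hp1 : p ≤ 1) (x y : 𝕜) :
    ‖x + y‖ ^ p ≤ ‖x‖ ^ p + ‖y‖ ^ p :=
  (Real.rpow_le_rpow (norm_nonneg _) (norm_add_le _ _) hp.le).trans
    (Real.rpow_add_le_add_rpow (norm_nonneg _) (norm_nonneg _) hp.le hp1)

theorem abs_norm_rpow_sub_le (hp : 0 < p) (hp1 : p ≤ 1) (x y : 𝕜) :
    |‖x‖ ^ p - ‖y‖ ^ p| ≤ ‖x + y‖ ^ p := by
  have h1 := norm_add_rpow_le hp hp1 (x + y) (-y)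
  have h2 := norm_add_rpow_le hp hp1 (x + y) (-x)
  rw [add_neg_cancel_right, norm_neg] at h1
  rw [add_neg_cancel_comm, norm_neg] at h2
  rw [abs_le]
  constructor <;> linarith

theorem isMass_coef (hp : 0 < p) (hp1 : p ≤ 1) (hδ : ∀ n, 2 ≤ δ n) (x : ℕ → 𝕜) :
    IsMass δ (fun j => ‖coef 𝕜 p δ j x‖ ^ p) (fun j => ‖x j‖ ^ p) where
  nonneg j := Real.rpow_nonneg (norm_nonneg _) _
  root := by simp only [coef_zero]
  step j hj := by
    have h := abs_norm_rpow_sub_le hp hp1 (coef 𝕜 p δ j x)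
      ((weight p δ (parent δ j) : 𝕜) * coef 𝕜 p δ (parent δ j) x)
    rw [norm_weight_mul_rpow hp] at h
    refine h.trans (le_of_eq ?_)
    rw [coef_of_ne_zero hδ hj, sub_add_cancel]

theorem apply_eq_zero_of_coef (hδ : ∀ n, 2 ≤ δ n) {N : ℕ} {x : ℕ → 𝕜}
    (hx : ∀ i, N ≤ i → coef 𝕜 p δ i x = 0) {j : ℕ} (hj : sigma δ N ≤ j) : x j = 0 := by
  have hj0 : j ≠ 0 := by have := lt_sigma hδ N; omega
  have h1 : N ≤ parent δ j := not_lt.1 fun h => absurd ((parent_lt_iff hδ hj0).1 h) (not_lt.2 hj)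
  have h2 := coef_of_ne_zero (p := p) hδ hj0 x
  rw [hx _ h1, hx j (h1.trans (parent_le hδ j))] at h2
  simpa using h2.symm

theorem memlp_ofReal_iff (hp : 0 < p) {x : ℕ → 𝕜} :
    Memℓp x (ENNReal.ofReal p) ↔ Summable fun j => ‖x j‖ ^ p := by
  have hpr : (ENNReal.ofReal p).toReal = p := ENNReal.toReal_ofReal hp.le
  rw [memℓp_gen_iff (by rwa [hpr]), hpr]

theorem norm_rpow_eq_tsum (hp : 0 < p) (x : ell 𝕜 p) : ‖x‖ ^ p = ∑' j, ‖x j‖ ^ p := by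
  have hpr : (ENNReal.ofReal p).toReal = p := ENNReal.toReal_ofReal hp.le
  have := lp.norm_rpow_eq_tsum (hpr.symm ▸ hp : 0 < (ENNReal.ofReal p).toReal) x
  rwa [hpr] at this

theorem summable_norm_rpow (hp : 0 < p) (x : ell 𝕜 p) : Summable fun j => ‖x j‖ ^ p := by
  have hpr : (ENNReal.ofReal p).toReal = p := ENNReal.toReal_ofReal hp.le
  have := (lp.memℓp x).summable (hpr.symm ▸ hp : 0 < (ENNReal.ofReal p).toReal)
  rwa [hpr] at this

theorem sum_norm_rpow_le (hp : 0 < p) (x : ell 𝕜 p) (A : Finset ℕ) :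
    ∑ j ∈ A, ‖x j‖ ^ p ≤ ‖x‖ ^ p := by
  rw [norm_rpow_eq_tsum hp]
  exact (summable_norm_rpow hp x).sum_le_tsum A fun j _ => Real.rpow_nonneg (norm_nonneg _) _

theorem norm_rpow_eq_sum (hp : 0 < p) (hδ : ∀ n, 2 ≤ δ n) {N : ℕ} {x : ell 𝕜 p}
    (hx : ∀ i, N ≤ i → coef 𝕜 p δ i x = 0) :
    ‖x‖ ^ p = ∑ j ∈ Finset.range (sigma δ N), ‖x j‖ ^ p := by
  rw [norm_rpow_eq_tsum hp]
  refine tsum_eq_sum fun j hj => ?_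
  rw [apply_eq_zero_of_coef hδ hx (by simpa using hj), norm_zero, Real.zero_rpow hp.ne']

theorem norm_coef_le (hp : 0 < p) (hp1 : p ≤ 1) (hδ : ∀ n, 2 ≤ δ n) (x : ell 𝕜 p) (j : ℕ) :
    ‖coef 𝕜 p δ j x‖ ^ p ≤ ‖x‖ ^ p :=
  ((isMass_coef hp hp1 hδ x).le_sum hδ j).trans (sum_norm_rpow_le hp x _)

/-- The first `N` coordinates of a vector of `[x_0, …, x_{N-1}]` control its norm. -/
theorem norm_rpow_le_two_mul_sum (hp : 0 < p) (hp1 : p ≤ 1) (hδ : ∀ n, 2 ≤ δ n) {N : ℕ}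
    {x : ell 𝕜 p} (hx : ∀ i, N ≤ i → coef 𝕜 p δ i x = 0) :
    ‖x‖ ^ p ≤ 2 * ∑ j ∈ Finset.range N, ‖x j‖ ^ p := by
  rw [norm_rpow_eq_sum hp hδ hx]
  rcases Nat.eq_zero_or_pos N with rfl | hN
  · have h0 : x 0 = 0 := by rw [← coef_zero (p := p) (δ := δ) (x : ℕ → 𝕜)]; exact hx 0 le_rfl
    simp [sigma_zero, h0, hp.ne']
  · have h1 := (isMass_coef hp hp1 hδ x).sum_cut_le hδ hN
    rw [Finset.range_eq_Ico, ← Finset.sum_Ico_consecutive _ (Nat.zero_le N) (lt_sigma hδ N).le,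
      two_mul, ← Finset.range_eq_Ico]
    refine add_le_add le_rfl (le_trans (le_of_eq (Finset.sum_congr rfl fun j hj => ?_)) h1)
    have hNj := (Finset.mem_Ico.1 hj).1
    have hj0 : j ≠ 0 := by omega
    have h2 := coef_of_ne_zero (p := p) hδ hj0 (x : ℕ → 𝕜)
    rw [hx j hNj] at h2
    rw [← norm_weight_mul_rpow hp, ← sub_eq_zero.1 h2.symm]

/-- Partial sums are bounded: if `y` has the first `M` coefficients of `x` and no others, then
`‖y‖^p ≤ 2 ‖x‖^p`. -/
theorem norm_rpow_truncate_le (hp : 0 < p) (hp1 : p ≤ 1) (hδ : ∀ n, 2 ≤ δ n) {M : ℕ}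
    {x y : ell 𝕜 p} (h : ∀ i, coef 𝕜 p δ i y = if i < M then coef 𝕜 p δ i x else 0) :
    ‖y‖ ^ p ≤ 2 * ‖x‖ ^ p := by
  refine (norm_rpow_le_two_mul_sum hp hp1 hδ (N := M) fun i hi => ?_).trans
    (mul_le_mul_of_nonneg_left (le_trans (le_of_eq ?_) (sum_norm_rpow_le hp x (Finset.range M)))
      zero_le_two)
  · rw [h, if_neg (by omega)]
  · refine Finset.sum_congr rfl fun j hj => ?_
    have h1 : (y : ℕ → 𝕜) j = (x : ℕ → 𝕜) j :=
      apply_congr_of_coef (p := p) hδ (N := M) (fun i hi => by rw [h, if_pos hi]) j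
        (Finset.mem_range.1 hj)
    rw [h1]

/-- The greedy projection bound in a single block. -/
theorem norm_rpow_greedy_le (hp : 0 < p) (hp1 : p ≤ 1) (hδ : ∀ n, 2 ≤ δ n) {N : ℕ}
    {x y : ell 𝕜 p} (hx : ∀ i, N ≤ i → coef 𝕜 p δ i x = 0) {τ : ℝ} (hτ : 0 ≤ τ) {A : Finset ℕ}
    (hA : A ⊆ Finset.range N) (hs : ∀ i ∈ A, τ ≤ ‖coef 𝕜 p δ i x‖ ^ p)
    (hs' : ∀ i ∉ A, ‖coef 𝕜 p δ i x‖ ^ p ≤ τ)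
    (h : ∀ i, coef 𝕜 p δ i y = if i ∈ A then coef 𝕜 p δ i x else 0) :
    ‖y‖ ^ p ≤ 10 * ‖x‖ ^ p := by
  have hy : ∀ i, N ≤ i → coef 𝕜 p δ i y = 0 := fun i hi => by
    rw [h, hx i hi, ite_self]
  have h00 : ‖(0 : 𝕜)‖ ^ p = 0 := by rw [norm_zero, Real.zero_rpow hp.ne']
  rw [norm_rpow_eq_sum hp hδ hx, norm_rpow_eq_sum hp hδ hy]
  refine (isMass_coef hp hp1 hδ x).sum_restrict_greedy_le hδ
    (fun j hj => by simp only [hx j hj, h00]) hτ hA hs hs' ?_ fun j hj => ?_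
  · simp only
    rw [← coef_zero (p := p) (δ := δ) (y : ℕ → 𝕜), h, ← coef_zero (p := p) (δ := δ) (x : ℕ → 𝕜)]
    split_ifs
    · exact le_rfl
    · rw [h00]; exact Real.rpow_nonneg (norm_nonneg _) _
  · simp only
    rw [← norm_weight_mul_rpow hp]
    have h1 : y j = coef 𝕜 p δ j y + (weight p δ (parent δ j) : 𝕜) * coef 𝕜 p δ (parent δ j) y := by
      rw [coef_of_ne_zero hδ hj]; ring
    have h2 : x j = coef 𝕜 p δ j x + (weight p δ (parent δ j) : 𝕜) * coef 𝕜 p δ (parent δ j) x := by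
      rw [coef_of_ne_zero hδ hj (x : ℕ → 𝕜)]; ring
    rw [h1, h2, h, h]
    by_cases h3 : j ∈ A <;> by_cases h4 : parent δ j ∈ A <;>
      simp [h3, h4, hp.ne']

/-! ### The vectors `x_i` -/

theorem mem_children_iff (hδ : ∀ n, 2 ≤ δ n) {i j : ℕ} :
    j ∈ Finset.Ico (sigma δ i) (sigma δ (i + 1)) ↔ j ≠ 0 ∧ parent δ j = i := by
  rw [Finset.mem_Ico]
  constructor
  · intro h
    have hj : j ≠ 0 := by have := lt_sigma hδ i; omega
    exact ⟨hj, (parent_eq_iff hδ hj).2 h⟩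
  · rintro ⟨hj, h⟩
    exact (parent_eq_iff hδ hj).1 h

theorem coe_linVec (hδ : ∀ n, 2 ≤ δ n) (i : ℕ) :
    (linVec 𝕜 p δ i : ℕ → 𝕜) = coordMap 𝕜 p δ (Pi.single i 1) := by
  funext j
  have h1 : ∀ k : ℕ, (lp.single (E := fun _ : ℕ => 𝕜) (ENNReal.ofReal p) k (1 : 𝕜)) j =
      if j = k then 1 else 0 := fun k => by
    rw [lp.single_apply, Pi.single_apply]
  rw [linVec, lp.coeFn_add, Pi.add_apply, lp.coeFn_smul, Pi.smul_apply, lp.coeFn_sum,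
    Finset.sum_apply, h1]
  simp only [h1]
  rw [Finset.sum_ite_eq]
  rcases eq_or_ne j 0 with rfl | hj
  · have h0 : 0 ∉ Finset.Ico (sigma δ i) (sigma δ (i + 1)) := fun h =>
      ((mem_children_iff hδ).1 h).1 rfl
    rw [coordMap_zero, Pi.single_apply, if_neg h0, smul_zero, add_zero]
  · rw [coordMap_of_ne_zero hj, Pi.single_apply, Pi.single_apply]
    congr 1
    by_cases h : parent δ j = i
    · rw [if_pos ((mem_children_iff hδ).2 ⟨hj, h⟩), if_pos h, h]; rfl
    · rw [if_neg (fun h' => h ((mem_children_iff hδ).1 h').2), if_neg h, smul_zero, mul_zero]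

theorem coef_linVec (hδ : ∀ n, 2 ≤ δ n) (i j : ℕ) :
    coef 𝕜 p δ j (linVec 𝕜 p δ i : ℕ → 𝕜) = if j = i then 1 else 0 := by
  rw [coe_linVec hδ, coef_coordMap hδ, Pi.single_apply]

theorem coef_eq_zero_of_mem (hδ : ∀ n, 2 ≤ δ n) {N : ℕ} {x : ell 𝕜 p}
    (hx : x ∈ linSpace 𝕜 p δ N) {i : ℕ} (hi : N ≤ i) : coef 𝕜 p δ i x = 0 := by
  induction hx using Submodule.span_induction with
  | mem x hx =>
    obtain ⟨k, hk, rfl⟩ := hx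
    rw [coef_linVec hδ, if_neg]
    have : k < N := hk
    omega
  | zero => rw [lp.coeFn_zero, map_zero]
  | add x y _ _ hx hy => rw [lp.coeFn_add, map_add, hx, hy, add_zero]
  | smul c x _ hx => rw [lp.coeFn_smul, map_smul, hx, smul_zero]

/-- The element `∑_{i < N} aᵢ xᵢ` of `X_p^{(N)}(δ)`. -/
def linComb (p : ℝ) (δ : ℕ → ℕ) (N : ℕ) (a : ℕ → 𝕜) : linSpace 𝕜 p δ N :=
  ∑ i : Fin N, a i • linBasis 𝕜 p δ N i

theorem coef_linComb (hδ : ∀ n, 2 ≤ δ n) (N : ℕ) (a : ℕ → 𝕜) (j : ℕ) :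
    coef 𝕜 p δ j (linComb p δ N a : ell 𝕜 p) = if j < N then a j else 0 := by
  have h : ((linComb p δ N a : ell 𝕜 p) : ℕ → 𝕜) =
      ∑ i : Fin N, a i • (linVec 𝕜 p δ i : ℕ → 𝕜) := by
    rw [linComb, Submodule.coe_sum, lp.coeFn_sum]
    exact Finset.sum_congr rfl fun i _ => by rw [Submodule.coe_smul, lp.coeFn_smul]; rfl
  rw [h, map_sum]
  simp only [map_smul, coef_linVec hδ, smul_eq_mul, mul_ite, mul_one, mul_zero]
  split_ifs with hj
  · rw [Finset.sum_eq_single ⟨j, hj⟩]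
    · simp
    · intro i _ hi
      rw [if_neg]
      rintro rfl
      exact hi rfl
    · simp
  · refine Finset.sum_eq_zero fun i _ => if_neg ?_
    have := i.isLt
    omega

theorem ext_coef (hδ : ∀ n, 2 ≤ δ n) {x y : ell 𝕜 p}
    (h : ∀ i, coef 𝕜 p δ i x = coef 𝕜 p δ i y) : x = y := by
  refine lp.ext ?_
  rw [← coordMap_coef (p := p) hδ (x : ℕ → 𝕜), ← coordMap_coef (p := p) hδ (y : ℕ → 𝕜)]
  simp only [h]

theorem norm_linVec_rpow (hp : 0 < p) (hδ : ∀ n, 2 ≤ δ n) (i : ℕ) : ‖linVec 𝕜 p δ i‖ ^ p = 2 := by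
  have hN : ∀ k, i + 1 ≤ k → coef 𝕜 p δ k (linVec 𝕜 p δ i : ℕ → 𝕜) = 0 := fun k hk => by
    rw [coef_linVec hδ, if_neg (by omega)]
  rw [norm_rpow_eq_sum hp hδ hN]
  have h1 : ∀ j ∈ Finset.range (sigma δ (i + 1)), ‖linVec 𝕜 p δ i j‖ ^ p =
      (if j = i then 1 else 0) +
        if j ∈ Finset.Ico (sigma δ i) (sigma δ (i + 1)) then (δ i : ℝ)⁻¹ else 0 := by
    intro j _
    rw [coe_linVec hδ]
    by_cases hji : j = i
    · subst hji
      rw [if_pos rfl, if_neg (by have := lt_sigma hδ j; simp; omega)]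
      rcases eq_or_ne j 0 with rfl | hj
      · rw [coordMap_zero]; simp
      · rw [coordMap_of_ne_zero hj, Pi.single_eq_same,
          Pi.single_eq_of_ne (parent_lt hδ hj).ne]
        simp
    · rw [if_neg hji]
      rcases eq_or_ne j 0 with rfl | hj
      · rw [coordMap_zero, Pi.single_eq_of_ne hji, if_neg (by rw [mem_children_iff hδ]; simp)]
        simp [hp.ne']
      · rw [coordMap_of_ne_zero hj, Pi.single_eq_of_ne hji, zero_add, norm_weight_mul_rpow hp,
          Pi.single_apply]
        by_cases h : parent δ j = i
        · rw [if_pos ((mem_children_iff hδ).2 ⟨hj, h⟩), if_pos h, h]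
          simp
        · rw [if_neg (fun h' => h ((mem_children_iff hδ).1 h').2), if_neg h]
          simp [hp.ne']
  rw [Finset.sum_congr rfl h1, Finset.sum_add_distrib, Finset.sum_ite_eq', if_pos,
    ← Finset.sum_filter, Finset.filter_mem_eq_inter, Finset.inter_eq_right.2]
  · have : (δ i : ℝ) ≠ 0 := by have := hδ i; positivity
    rw [Finset.sum_const, Nat.card_Ico, sigma_succ, Nat.add_sub_cancel_left, nsmul_eq_mul,
      mul_inv_cancel₀ this]
    norm_num
  · intro j hj
    exact Finset.mem_range.2 (Finset.mem_Ico.1 hj).2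
  · have := lt_sigma hδ (i + 1)
    exact Finset.mem_range.2 (by omega)

/-! ### The unit mass at the root -/

variable (𝕜) in
/-- The coefficients of the formal expansion of `e_0`: `1` at the root, and then such that all
other coordinates vanish. Their `p`-th powers spread a unit mass over each level of the tree. -/
def rootCoef (p : ℝ) (δ : ℕ → ℕ) (j : ℕ) : 𝕜 := coef 𝕜 p δ j (Pi.single 0 1)

theorem rootCoef_zero : rootCoef 𝕜 p δ 0 = 1 := by
  rw [rootCoef, coef_zero, Pi.single_eq_same]

theorem rootCoef_of_ne_zero (hδ : ∀ n, 2 ≤ δ n) {j : ℕ} (hj : j ≠ 0) :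
    rootCoef 𝕜 p δ j = -((weight p δ (parent δ j) : 𝕜) * rootCoef 𝕜 p δ (parent δ j)) := by
  rw [rootCoef, coef_of_ne_zero hδ hj, Pi.single_eq_of_ne hj, zero_sub, rootCoef]

theorem norm_rootCoef_rpow (hp : 0 < p) (hδ : ∀ n, 2 ≤ δ n) {j : ℕ} (hj : j ≠ 0) :
    ‖rootCoef 𝕜 p δ j‖ ^ p = ‖rootCoef 𝕜 p δ (parent δ j)‖ ^ p / δ (parent δ j) := by
  rw [rootCoef_of_ne_zero hδ hj, norm_neg, norm_weight_mul_rpow hp]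

theorem norm_rootCoef_le (hp : 0 < p) (hδ : ∀ n, 2 ≤ δ n) (j : ℕ) : ‖rootCoef 𝕜 p δ j‖ ≤ 1 := by
  induction j using Nat.strong_induction_on with
  | _ j ih =>
    rcases eq_or_ne j 0 with rfl | hj
    · simp [rootCoef_zero]
    · have h1 : (1 : ℝ) ≤ δ (parent δ j) := by
        exact_mod_cast (one_le_two.trans (hδ (parent δ j)))
      have h2 : weight p δ (parent δ j) ≤ 1 :=
        Real.rpow_le_one_of_one_le_of_nonpos h1 (by simp [hp.le])
      rw [rootCoef_of_ne_zero hδ hj, norm_neg, norm_mul, RCLike.norm_ofReal,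
        abs_of_nonneg (weight_nonneg p δ _)]
      exact mul_le_one₀ h2 (norm_nonneg _) (ih _ (parent_lt hδ hj))

/-- The depth of a position in the tree. -/
def depth (δ : ℕ → ℕ) (j : ℕ) : ℕ := if _h : parent δ j < j then depth δ (parent δ j) + 1 else 0

theorem depth_zero : depth δ 0 = 0 := by rw [depth]; simp

theorem depth_of_ne_zero (hδ : ∀ n, 2 ≤ δ n) {j : ℕ} (hj : j ≠ 0) :
    depth δ j = depth δ (parent δ j) + 1 := by
  rw [depth, dif_pos (parent_lt hδ hj)]

/-- Every truncation of the expansion of `e_0` has norm at most `2^{1/p}`, because partial sums are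
bounded. -/
theorem norm_root_truncate_le (hp : 0 < p) (hp1 : p ≤ 1) (hδ : ∀ n, 2 ≤ δ n) {M : ℕ} {x : ell 𝕜 p}
    (hx : ∀ i, coef 𝕜 p δ i x = if i < M then rootCoef 𝕜 p δ i else 0) : ‖x‖ ^ p ≤ 2 := by
  have h0 : ∀ i, coef 𝕜 p δ i (lp.single (E := fun _ : ℕ => 𝕜) (ENNReal.ofReal p) 0 (1 : 𝕜)) =
      rootCoef 𝕜 p δ i := fun i => by rw [rootCoef, lp.coeFn_single]
  have h1 := norm_rpow_truncate_le hp hp1 hδ (M := M) (y := x)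
    (x := lp.single (E := fun _ : ℕ => 𝕜) (ENNReal.ofReal p) 0 (1 : 𝕜))
    fun i => by rw [hx, h0]
  rwa [lp.norm_single (by simpa using hp), norm_one, Real.one_rpow, mul_one] at h1

/-- The positions of even depth carry a part of the expansion of `e_0` that grows with the number of
levels: each edge of the tree has exactly one end of even depth, so no coordinate cancels. -/
theorem le_norm_root_even (hp : 0 < p) (hδ : ∀ n, 2 ≤ δ n) {n : ℕ} {x : ell 𝕜 p}
    (hx : ∀ i < levelStart δ n,
      coef 𝕜 p δ i x = if Even (depth δ i) then rootCoef 𝕜 p δ i else 0) :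
    (n : ℝ) ≤ ‖x‖ ^ p := by
  have h1 := IsMass.sum_range_levelStart (s := fun j => ‖rootCoef 𝕜 p δ j‖ ^ p) hδ
    (by simp [rootCoef_zero]) (fun j hj => norm_rootCoef_rpow hp hδ hj) n
  rw [← h1]
  refine le_trans (le_of_eq (Finset.sum_congr rfl fun j hj => ?_)) (sum_norm_rpow_le hp x _)
  have hj := Finset.mem_range.1 hj
  rcases eq_or_ne j 0 with rfl | hj0
  · rw [← coef_zero (p := p) (δ := δ) (x : ℕ → 𝕜), hx 0 hj, if_pos (by rw [depth_zero]; simp)]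
  · have hpj := parent_lt hδ hj0
    have h2 : x j = coef 𝕜 p δ j x + (weight p δ (parent δ j) : 𝕜) * coef 𝕜 p δ (parent δ j) x := by
      rw [coef_of_ne_zero hδ hj0 (x : ℕ → 𝕜)]; ring
    have h4 : Even (depth δ j) ↔ ¬ Even (depth δ (parent δ j)) := by
      rw [depth_of_ne_zero hδ hj0, Nat.even_add_one]
    rw [h2, hx j hj, hx _ (hpj.trans hj)]
    by_cases h3 : Even (depth δ (parent δ j))
    · simp only [h4, h3, not_true, if_true, if_false, zero_add]
      rw [rootCoef_of_ne_zero hδ hj0, norm_neg]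
    · simp only [h4, h3, not_false_iff, if_true, if_false, mul_zero, add_zero]

end Coordinates

/-! ### `p`-norms -/

namespace IsPNorm

variable {p : ℝ} {𝕜 E : Type*} [RCLike 𝕜] [AddCommGroup E] [Module 𝕜 E] [Norm E]

theorem norm_zero' (h : IsPNorm p 𝕜 E) : ‖(0 : E)‖ = 0 := by
  simpa using h.smul (0 : 𝕜) (0 : E)

theorem norm_neg' (h : IsPNorm p 𝕜 E) (x : E) : ‖-x‖ = ‖x‖ := by
  simpa using h.smul (-1 : 𝕜) x

theorem rpow_nonneg (h : IsPNorm p 𝕜 E) (x : E) : 0 ≤ ‖x‖ ^ p := Real.rpow_nonneg (h.nonneg x) p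

theorem zero_rpow (h : IsPNorm p 𝕜 E) : ‖(0 : E)‖ ^ p = 0 := by
  rw [h.norm_zero', Real.zero_rpow h.pos.ne']

theorem smul_rpow (h : IsPNorm p 𝕜 E) (c : 𝕜) (x : E) : ‖c • x‖ ^ p = ‖c‖ ^ p * ‖x‖ ^ p := by
  rw [h.smul, Real.mul_rpow (norm_nonneg c) (h.nonneg x)]

theorem sub_rpow_le (h : IsPNorm p 𝕜 E) (x y : E) : ‖x - y‖ ^ p ≤ ‖x‖ ^ p + ‖y‖ ^ p := by
  have := h.triangle x (-y)
  rwa [← sub_eq_add_neg, h.norm_neg'] at this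

theorem sum_rpow_le (h : IsPNorm p 𝕜 E) {ι : Type*} (A : Finset ι) (x : ι → E) :
    ‖∑ i ∈ A, x i‖ ^ p ≤ ∑ i ∈ A, ‖x i‖ ^ p := by
  classical
  induction A using Finset.induction_on with
  | empty => simp [h.zero_rpow]
  | insert i A hi ih =>
    rw [Finset.sum_insert hi, Finset.sum_insert hi]
    exact (h.triangle _ _).trans (add_le_add le_rfl ih)

theorem le_of_rpow_le (h : IsPNorm p 𝕜 E) {x y : E} {C : ℝ} (hC : 0 ≤ C)
    (hxy : ‖x‖ ^ p ≤ C * ‖y‖ ^ p) : ‖x‖ ≤ C ^ (1 / p) * ‖y‖ := by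
  have h1 : 0 ≤ C ^ (1 / p) := Real.rpow_nonneg hC _
  rw [← Real.rpow_le_rpow_iff (h.nonneg x) (mul_nonneg h1 (h.nonneg y)) h.pos,
    Real.mul_rpow h1 (h.nonneg y), ← Real.rpow_mul hC, one_div_mul_cancel h.pos.ne', Real.rpow_one]
  exact hxy

end IsPNorm

namespace lpSum

variable {p : ℝ} {𝕜 : Type*} {E : ℕ → Type*} [RCLike 𝕜] [∀ k, AddCommGroup (E k)]
  [∀ k, Module 𝕜 (E k)] [∀ k, Norm (E k)] [hE : ∀ k, IsPNorm p 𝕜 (E k)]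

theorem norm_rpow_eq_tsum (f : lpSum p 𝕜 E) : ‖f‖ ^ p = ∑' k, ‖(f : ∀ k, E k) k‖ ^ p := by
  have h : ‖f‖ = (∑' k, ‖(f : ∀ k, E k) k‖ ^ p) ^ (1 / p) := rfl
  rw [h, ← Real.rpow_mul (tsum_nonneg fun k => (hE k).rpow_nonneg _),
    one_div_mul_cancel (hE 0).pos.ne', Real.rpow_one]

theorem summable_norm_rpow (f : lpSum p 𝕜 E) : Summable fun k => ‖(f : ∀ k, E k) k‖ ^ p := f.2

variable (p 𝕜 E) in
theorem isPNorm : IsPNorm p 𝕜 (lpSum p 𝕜 E) where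
  pos := (hE 0).pos
  le_one := (hE 0).le_one
  nonneg f := Real.rpow_nonneg (tsum_nonneg fun k => (hE k).rpow_nonneg _) _
  eq_zero f hf := by
    have h1 := norm_rpow_eq_tsum f
    rw [hf, Real.zero_rpow (hE 0).pos.ne'] at h1
    have h2 := (summable_norm_rpow f).hasSum
    rw [← h1] at h2
    have h3 := (hasSum_zero_iff_of_nonneg fun k => (hE k).rpow_nonneg _).1 h2
    refine Subtype.ext (funext fun k => (hE k).eq_zero _ ?_)
    have h4 : ‖(f : ∀ k, E k) k‖ ^ p = 0 := congrFun h3 k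
    exact (Real.rpow_eq_zero ((hE k).nonneg _) (hE k).pos.ne').1 h4
  smul c f := by
    have h : ∀ k, ‖((c • f : lpSum p 𝕜 E) : ∀ k, E k) k‖ ^ p =
        ‖c‖ ^ p * ‖(f : ∀ k, E k) k‖ ^ p := fun k => (hE k).smul_rpow c _
    have h1 : ‖c • f‖ = (∑' k, ‖((c • f : lpSum p 𝕜 E) : ∀ k, E k) k‖ ^ p) ^ (1 / p) := rfl
    rw [h1]
    simp only [h]
    rw [tsum_mul_left, Real.mul_rpow (Real.rpow_nonneg (norm_nonneg c) _)
      (tsum_nonneg fun k => (hE k).rpow_nonneg _), ← Real.rpow_mul (norm_nonneg c),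
      mul_one_div_cancel (hE 0).pos.ne', Real.rpow_one]
    rfl
  triangle f g := by
    rw [norm_rpow_eq_tsum, norm_rpow_eq_tsum, norm_rpow_eq_tsum,
      ← (summable_norm_rpow f).tsum_add (summable_norm_rpow g)]
    exact (summable_norm_rpow (f + g)).tsum_le_tsum (fun k => (hE k).triangle _ _)
      ((summable_norm_rpow f).add (summable_norm_rpow g))

end lpSum

/-! ### Concatenation of the blocks -/

section Blocks

variable {η : ℕ → ℕ+}

theorem blockStart_succ (η : ℕ → ℕ+) (k : ℕ) : blockStart η (k + 1) = blockStart η k + η k := by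
  simp [blockStart, Finset.sum_range_succ]

theorem blockStart_mono (η : ℕ → ℕ+) : Monotone (blockStart η) :=
  monotone_nat_of_le_succ fun k => by simp [blockStart_succ]

theorem block_add {k i : ℕ} (hi : i < η k) : block η (blockStart η k + i) = k := by
  have h1 := blockStart_le η (blockStart η k + i)
  have h2 := lt_blockStart η (blockStart η k + i)
  have h3 := blockStart_succ η k
  by_contra hne
  rcases lt_or_gt_of_ne hne with h | h
  · have := blockStart_mono η (Nat.succ_le_of_lt h)
    simp only [Nat.succ_eq_add_one] at this
    omega
  · have := blockStart_mono η (Nat.succ_le_of_lt h)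
    simp only [Nat.succ_eq_add_one] at this
    omega

theorem blockPos_add {k i : ℕ} (hi : i < η k) : (blockPos η (blockStart η k + i) : ℕ) = i := by
  simp [blockPos, block_add hi]

theorem blockStart_add_blockPos (η : ℕ → ℕ+) (n : ℕ) :
    blockStart η (block η n) + blockPos η n = n := by
  have := blockStart_le η n
  simp only [blockPos]
  omega

/-- Numbering of the pairs (block, position in the block). -/
def blockEquiv (η : ℕ → ℕ+) : (Σ k, Fin (η k)) ≃ ℕ where
  toFun x := blockStart η x.1 + x.2
  invFun n := ⟨block η n, blockPos η n⟩
  left_inv x := by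
    obtain ⟨k, i⟩ := x
    have h : block η (blockStart η k + i) = k := block_add i.isLt
    refine Sigma.ext h ?_
    rw [Fin.heq_ext_iff (by simp only [h])]
    exact blockPos_add i.isLt
  right_inv n := blockStart_add_blockPos η n

/-- The positions in the block `k` of the indices that belong to `A`. -/
def blockSet (η : ℕ → ℕ+) (A : Finset ℕ) (k : ℕ) : Finset ℕ :=
  (Finset.range (η k)).filter fun i => blockStart η k + i ∈ A

theorem mem_blockSet {A : Finset ℕ} {k i : ℕ} :
    i ∈ blockSet η A k ↔ i < η k ∧ blockStart η k + i ∈ A := by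
  simp [blockSet]

theorem blockSet_subset (η : ℕ → ℕ+) (A : Finset ℕ) (k : ℕ) :
    blockSet η A k ⊆ Finset.range (η k) := Finset.filter_subset _ _

theorem card_blockSet_le (η : ℕ → ℕ+) (A : Finset ℕ) (k : ℕ) :
    (blockSet η A k).card ≤ A.card :=
  Finset.card_le_card_of_injOn (fun i => blockStart η k + i)
    (fun _ hi => (mem_blockSet.1 hi).2) fun _ _ _ _ h => Nat.add_left_cancel h

theorem sum_filter_block (A : Finset ℕ) (F : ℕ → ℝ) (k : ℕ) :
    ∑ n ∈ A with block η n = k, F n = ∑ i ∈ blockSet η A k, F (blockStart η k + i) := by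
  symm
  refine Finset.sum_nbij (fun i => blockStart η k + i) (fun i hi => ?_)
    (fun _ _ _ _ h => Nat.add_left_cancel h) (fun n hn => ?_) fun _ _ => rfl
  · obtain ⟨h1, h2⟩ := mem_blockSet.1 hi
    exact Finset.mem_filter.2 ⟨h2, block_add h1⟩
  · obtain ⟨h1, rfl⟩ := Finset.mem_filter.1 hn
    have h2 := blockStart_add_blockPos η n
    exact ⟨blockPos η n, mem_blockSet.2 ⟨(blockPos η n).isLt, by rwa [h2]⟩, h2⟩

end Blocks

/-! ### The space `Y` and its coefficient functionals -/

section YSpace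

variable {𝕜 : Type*} [RCLike 𝕜] {p : ℝ} [hp : Fact (0 < p)] [hp1 : Fact (p ≤ 1)] {δ : ℕ → ℕ}
  {η : ℕ → ℕ+}

/-- The component of `f` in the block `k`, as a vector of `ℓ_p`. -/
def component (f : YSpace 𝕜 p δ η) (k : ℕ) : ell 𝕜 p :=
  ((f : ∀ k, linSpace 𝕜 p δ (η k)) k : linSpace 𝕜 p δ (η k))

variable (𝕜 p δ η) in
/-- The coefficient functionals of the basis of `Y`. -/
def yCoef (n : ℕ) : YSpace 𝕜 p δ η →ₗ[𝕜] 𝕜 where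
  toFun f := coef 𝕜 p δ (blockPos η n) (component f (block η n))
  map_add' f g := by
    rw [← map_add, ← lp.coeFn_add]; rfl
  map_smul' c f := by
    rw [RingHom.id_apply, ← map_smul, ← lp.coeFn_smul]; rfl

theorem norm_rpow_eq_tsum_component (f : YSpace 𝕜 p δ η) :
    ‖f‖ ^ p = ∑' k, ‖component f k‖ ^ p := lpSum.norm_rpow_eq_tsum f

theorem summable_component (f : YSpace 𝕜 p δ η) : Summable fun k => ‖component f k‖ ^ p :=
  lpSum.summable_norm_rpow f

theorem component_rpow_nonneg (f : YSpace 𝕜 p δ η) (k : ℕ) : 0 ≤ ‖component f k‖ ^ p :=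
  (ell.isPNorm 𝕜 p).rpow_nonneg _

theorem norm_component_rpow_le (f : YSpace 𝕜 p δ η) (k : ℕ) :
    ‖component f k‖ ^ p ≤ ‖f‖ ^ p := by
  rw [norm_rpow_eq_tsum_component]
  exact (summable_component f).le_tsum k fun k _ => component_rpow_nonneg f k

theorem norm_rpow_le_of_component {f g : YSpace 𝕜 p δ η} {C : ℝ}
    (h : ∀ k, ‖component f k‖ ^ p ≤ C * ‖component g k‖ ^ p) : ‖f‖ ^ p ≤ C * ‖g‖ ^ p := by
  rw [norm_rpow_eq_tsum_component, norm_rpow_eq_tsum_component, ← tsum_mul_left]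
  exact (summable_component f).tsum_le_tsum h ((summable_component g).mul_left C)

/-- Estimates of finite sums of coefficients may be checked on each block. -/
theorem sum_le_of_blockSet {f : YSpace 𝕜 p δ η} {A : Finset ℕ} {F : ℕ → ℝ} {κ : ℝ} (hκ : 0 ≤ κ)
    (h : ∀ k, ∑ i ∈ blockSet η A k, F (blockStart η k + i) ≤ κ * ‖component f k‖ ^ p) :
    ∑ n ∈ A, F n ≤ κ * ‖f‖ ^ p := by
  rw [← Finset.sum_fiberwise_of_maps_to (t := A.image (block η)) (g := block η)
    fun n hn => Finset.mem_image_of_mem _ hn]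
  simp only [sum_filter_block]
  rw [norm_rpow_eq_tsum_component, ← tsum_mul_left]
  exact (Finset.sum_le_sum fun k _ => h k).trans (((summable_component f).mul_left κ).sum_le_tsum _
    fun k _ => mul_nonneg hκ (component_rpow_nonneg f k))

theorem yCoef_add {k i : ℕ} (hi : i < η k) (f : YSpace 𝕜 p δ η) :
    yCoef 𝕜 p δ η (blockStart η k + i) f = coef 𝕜 p δ i (component f k) := by
  show coef 𝕜 p δ (blockPos η (blockStart η k + i) : ℕ)
    (component f (block η (blockStart η k + i))) = _
  rw [blockPos_add hi, block_add hi]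

theorem coef_component_eq_zero (hδ : ∀ n, 2 ≤ δ n) (f : YSpace 𝕜 p δ η) {k i : ℕ} (hi : η k ≤ i) :
    coef 𝕜 p δ i (component f k) = 0 :=
  coef_eq_zero_of_mem hδ ((f : ∀ k, linSpace 𝕜 p δ (η k)) k).2 hi

theorem ext_yCoef (hδ : ∀ n, 2 ≤ δ n) {f g : YSpace 𝕜 p δ η}
    (h : ∀ n, yCoef 𝕜 p δ η n f = yCoef 𝕜 p δ η n g) : f = g := by
  refine Subtype.ext (funext fun k => Subtype.ext (ext_coef hδ fun i => ?_))
  rcases lt_or_ge i (η k : ℕ) with hi | hi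
  · have := h (blockStart η k + i)
    rwa [yCoef_add hi, yCoef_add hi] at this
  · exact (coef_component_eq_zero hδ f hi).trans (coef_component_eq_zero hδ g hi).symm

theorem component_yBasis (n k : ℕ) :
    component (yBasis 𝕜 p δ η n) k = if k = block η n then linVec 𝕜 p δ (blockPos η n) else 0 := by
  split_ifs with h
  · subst h
    simp [component, yBasis, lpSum.single, linBasis]
  · simp [component, yBasis, lpSum.single, Pi.single_eq_of_ne h]

theorem yCoef_yBasis (hδ : ∀ n, 2 ≤ δ n) (n m : ℕ) :
    yCoef 𝕜 p δ η n (yBasis 𝕜 p δ η m) = if n = m then 1 else 0 := by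
  show coef 𝕜 p δ (blockPos η n : ℕ) (component (yBasis 𝕜 p δ η m) (block η n)) = _
  rw [component_yBasis]
  by_cases h : block η n = block η m
  · rw [if_pos h, coef_linVec hδ]
    have h1 := blockStart_add_blockPos η n
    have h2 := blockStart_add_blockPos η m
    have h4 := congrArg (blockStart η) h
    have h3 : (blockPos η n : ℕ) = blockPos η m ↔ n = m := by
      constructor
      · intro h3; omega
      · rintro rfl; rfl
    simp only [h3]
  · rw [if_neg h, if_neg fun h' => h (congrArg _ h'), lp.coeFn_zero, map_zero]

theorem norm_yBasis_rpow (hδ : ∀ n, 2 ≤ δ n) (n : ℕ) : ‖yBasis 𝕜 p δ η n‖ ^ p = 2 := by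
  rw [norm_rpow_eq_tsum_component, tsum_eq_single (block η n)]
  · rw [component_yBasis, if_pos rfl, norm_linVec_rpow hp.out hδ]
  · intro k hk
    rw [component_yBasis, if_neg hk, (ell.isPNorm 𝕜 p).zero_rpow]

theorem norm_yCoef_rpow_le (hδ : ∀ n, 2 ≤ δ n) (n : ℕ) (f : YSpace 𝕜 p δ η) :
    ‖yCoef 𝕜 p δ η n f‖ ^ p ≤ ‖f‖ ^ p :=
  (norm_coef_le hp.out hp1.out hδ _ _).trans (norm_component_rpow_le f _)

theorem norm_yCoef_le (hδ : ∀ n, 2 ≤ δ n) (n : ℕ) (f : YSpace 𝕜 p δ η) :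
    ‖yCoef 𝕜 p δ η n f‖ ≤ ‖f‖ :=
  (Real.rpow_le_rpow_iff (norm_nonneg _) ((lpSum.isPNorm p 𝕜 _).nonneg f) hp.out).1
    (norm_yCoef_rpow_le hδ n f)

theorem yCoef_sum (hδ : ∀ n, 2 ≤ δ n) (A : Finset ℕ) (a : ℕ → 𝕜) (n : ℕ) :
    yCoef 𝕜 p δ η n (∑ m ∈ A, a m • yBasis 𝕜 p δ η m) = if n ∈ A then a n else 0 := by
  rw [map_sum]
  simp only [map_smul, yCoef_yBasis hδ, smul_eq_mul, mul_ite, mul_one, mul_zero]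
  rw [Finset.sum_ite_eq]

theorem coordProj_apply {Y : Type*} [AddCommGroup Y] [Module 𝕜 Y] (y : ℕ → Y)
    (φ : ℕ → Y →ₗ[𝕜] 𝕜) (A : Finset ℕ) (f : Y) :
    coordProj y φ A f = ∑ n ∈ A, φ n f • y n := by
  simp [coordProj]

theorem yCoef_coordProj (hδ : ∀ n, 2 ≤ δ n) (A : Finset ℕ) (f : YSpace 𝕜 p δ η) (n : ℕ) :
    yCoef 𝕜 p δ η n (coordProj (yBasis 𝕜 p δ η) (yCoef 𝕜 p δ η) A f) =
      if n ∈ A then yCoef 𝕜 p δ η n f else 0 := by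
  rw [coordProj_apply, yCoef_sum hδ]

theorem coef_component_coordProj (hδ : ∀ n, 2 ≤ δ n) (A : Finset ℕ) (f : YSpace 𝕜 p δ η)
    (k i : ℕ) :
    coef 𝕜 p δ i (component (coordProj (yBasis 𝕜 p δ η) (yCoef 𝕜 p δ η) A f) k) =
      if i ∈ blockSet η A k then coef 𝕜 p δ i (component f k) else 0 := by
  rcases lt_or_ge i (η k : ℕ) with hi | hi
  · rw [← yCoef_add hi, yCoef_coordProj hδ, yCoef_add hi]
    simp only [mem_blockSet, hi, true_and]
  · rw [coef_component_eq_zero hδ _ hi, coef_component_eq_zero hδ _ hi, ite_self]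

/-- Greedy projections are uniformly bounded. -/
theorem norm_coordProj_greedy_le (hδ : ∀ n, 2 ≤ δ n) {f : YSpace 𝕜 p δ η} {A : Finset ℕ} {τ : ℝ}
    (hτ : 0 ≤ τ) (hs : ∀ n ∈ A, τ ≤ ‖yCoef 𝕜 p δ η n f‖ ^ p)
    (hs' : ∀ n ∉ A, ‖yCoef 𝕜 p δ η n f‖ ^ p ≤ τ) :
    ‖coordProj (yBasis 𝕜 p δ η) (yCoef 𝕜 p δ η) A f‖ ^ p ≤ 10 * ‖f‖ ^ p := by
  refine norm_rpow_le_of_component fun k => norm_rpow_greedy_le hp.out hp1.out hδ (N := η k)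
    (fun i hi => coef_component_eq_zero hδ f hi) hτ (blockSet_subset η A k) (fun i hi => ?_)
    (fun i hi => ?_) (coef_component_coordProj hδ A f k)
  · obtain ⟨h1, h2⟩ := mem_blockSet.1 hi
    rw [← yCoef_add h1]
    exact hs _ h2
  · rcases lt_or_ge i (η k : ℕ) with h1 | h1
    · rw [← yCoef_add h1]
      exact hs' _ fun h2 => hi (mem_blockSet.2 ⟨h1, h2⟩)
    · rw [coef_component_eq_zero hδ _ h1, norm_zero, Real.zero_rpow hp.out.ne']
      exact hτ

theorem sum_component_eq (hδ : ∀ n, 2 ≤ δ n) (f : YSpace 𝕜 p δ η) (k : ℕ) :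
    ∑ j ∈ Finset.range (sigma δ (η k)), ‖component f k j‖ ^ p = ‖component f k‖ ^ p :=
  (norm_rpow_eq_sum hp.out hδ fun _ hi => coef_component_eq_zero hδ f hi).symm

/-- The weak-type estimate in `Y`. -/
theorem card_large_coef_le (hδ : ∀ n, 2 ≤ δ n) {f : YSpace 𝕜 p δ η} {A : Finset ℕ} {τ : ℝ}
    (hτ : 0 ≤ τ) (hs : ∀ n ∈ A, τ ≤ ‖yCoef 𝕜 p δ η n f‖ ^ p) :
    A.card * τ ≤ 2 * ‖f‖ ^ p := by
  rw [← nsmul_eq_mul, ← Finset.sum_const]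
  refine sum_le_of_blockSet (F := fun _ => τ) zero_le_two fun k => ?_
  rw [← sum_component_eq hδ]
  refine (isMass_coef hp.out hp1.out hδ _).sum_large_le hδ (N := η k) (fun j hj => ?_) hτ
    (blockSet_subset η A k) fun i hi => ?_
  · simp only
    rw [coef_component_eq_zero hδ f hj, norm_zero, Real.zero_rpow hp.out.ne']
  · obtain ⟨h1, h2⟩ := mem_blockSet.1 hi
    simp only
    rw [← yCoef_add h1]
    exact hs _ h2

/-- Each block contains at most `|A|` of the indices in `A`, so the estimate for a single tree
applies blockwise. -/
theorem sum_norm_yCoef_le (hδ : ∀ n, 2 ≤ δ n) (hmono : Monotone δ) (f : YSpace 𝕜 p δ η) {n : ℕ}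
    {A : Finset ℕ} (hA : A.card ≤ levelStart δ n) :
    ∑ m ∈ A, ‖yCoef 𝕜 p δ η m f‖ ^ p ≤ (n + 1) * ‖f‖ ^ p := by
  refine sum_le_of_blockSet (by positivity) fun k => ?_
  refine le_trans (le_of_eq (Finset.sum_congr rfl fun i hi => ?_))
    ((isMass_coef hp.out hp1.out hδ (component f k)).sum_finset_le hδ hmono
      (fun K => sum_norm_rpow_le hp.out (component f k) (Finset.range K)) (A := blockSet η A k)
      ((card_blockSet_le η A k).trans hA))
  rw [yCoef_add (mem_blockSet.1 hi).1]

end YSpace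

section YSpace

variable {𝕜 : Type*} [RCLike 𝕜] {p : ℝ} [hp : Fact (0 < p)] [hp1 : Fact (p ≤ 1)] {δ : ℕ → ℕ}
  {η : ℕ → ℕ+}

/-! ### The isomorphism with `ℓ_p` -/

theorem sum_fin_component_le (f : YSpace 𝕜 p δ η) (k : ℕ) :
    ∑ i : Fin (η k), ‖component f k i‖ ^ p ≤ ‖component f k‖ ^ p := by
  rw [Fin.sum_univ_eq_sum_range (fun i => ‖component f k i‖ ^ p)]
  exact sum_norm_rpow_le hp.out _ _

theorem le_two_mul_sum_fin_component (hδ : ∀ n, 2 ≤ δ n) (f : YSpace 𝕜 p δ η) (k : ℕ) :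
    ‖component f k‖ ^ p ≤ 2 * ∑ i : Fin (η k), ‖component f k i‖ ^ p := by
  rw [Fin.sum_univ_eq_sum_range (fun i => ‖component f k i‖ ^ p)]
  exact norm_rpow_le_two_mul_sum hp.out hp1.out hδ fun i hi => coef_component_eq_zero hδ f hi

theorem summable_sigma_component (f : YSpace 𝕜 p δ η) :
    Summable fun x : Σ k, Fin (η k) => ‖component f x.1 x.2‖ ^ p := by
  rw [summable_sigma_of_nonneg fun x => Real.rpow_nonneg (norm_nonneg _) _]
  refine ⟨fun k => (hasSum_fintype _).summable, ?_⟩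
  refine Summable.of_nonneg_of_le (fun k => tsum_nonneg fun i => Real.rpow_nonneg (norm_nonneg _) _)
    (fun k => ?_) (summable_component f)
  rw [tsum_fintype]
  exact sum_fin_component_le f k

/-- The map that keeps, of each block of `N_k` vectors, the first `N_k` coordinates. -/
def toEll (p : ℝ) [Fact (0 < p)] [Fact (p ≤ 1)] (δ : ℕ → ℕ) (η : ℕ → ℕ+) :
    YSpace 𝕜 p δ η →ₗ[𝕜] ell 𝕜 p where
  toFun f := ⟨fun n => component f (block η n) (blockPos η n), (memlp_ofReal_iff Fact.out).2 <| by
    exact (blockEquiv η).symm.summable_iff.2 (summable_sigma_component f)⟩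
  map_add' f g := rfl
  map_smul' c f := rfl

theorem norm_toEll_rpow (f : YSpace 𝕜 p δ η) :
    ‖toEll p δ η f‖ ^ p = ∑' k, ∑ i : Fin (η k), ‖component f k i‖ ^ p := by
  rw [norm_rpow_eq_tsum hp.out]
  have h := (blockEquiv η).symm.tsum_eq fun x : Σ k, Fin (η k) => ‖component f x.1 x.2‖ ^ p
  refine Eq.trans h ?_
  rw [(summable_sigma_component f).tsum_sigma' fun _ => (hasSum_fintype _).summable]
  simp only [tsum_fintype]

theorem summable_sum_fin_component (f : YSpace 𝕜 p δ η) :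
    Summable fun k => ∑ i : Fin (η k), ‖component f k i‖ ^ p :=
  Summable.of_nonneg_of_le
    (fun _ => Finset.sum_nonneg fun _ _ => Real.rpow_nonneg (norm_nonneg _) _)
    (sum_fin_component_le f) (summable_component f)

theorem norm_toEll_rpow_le (f : YSpace 𝕜 p δ η) : ‖toEll p δ η f‖ ^ p ≤ ‖f‖ ^ p := by
  rw [norm_toEll_rpow, norm_rpow_eq_tsum_component]
  exact (summable_sum_fin_component f).tsum_le_tsum (sum_fin_component_le f) (summable_component f)

theorem le_norm_toEll_rpow (hδ : ∀ n, 2 ≤ δ n) (f : YSpace 𝕜 p δ η) :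
    ‖f‖ ^ p ≤ 2 * ‖toEll p δ η f‖ ^ p := by
  rw [norm_toEll_rpow, norm_rpow_eq_tsum_component, ← tsum_mul_left]
  exact (summable_component f).tsum_le_tsum (le_two_mul_sum_fin_component hδ f)
    ((summable_sum_fin_component f).mul_left 2)

theorem toEll_injective (hδ : ∀ n, 2 ≤ δ n) : Function.Injective (toEll (𝕜 := 𝕜) p δ η) := by
  rw [← LinearMap.ker_eq_bot, LinearMap.ker_eq_bot']
  intro f hf
  have hY := lpSum.isPNorm p 𝕜 fun k => linSpace 𝕜 p δ (η k)
  have h := le_norm_toEll_rpow hδ f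
  rw [hf, (ell.isPNorm 𝕜 p).zero_rpow, mul_zero] at h
  exact hY.eq_zero f ((Real.rpow_eq_zero (hY.nonneg f) hp.out.ne').1
    (le_antisymm h (hY.rpow_nonneg f)))

theorem toEll_surjective (hδ : ∀ n, 2 ≤ δ n) : Function.Surjective (toEll (𝕜 := 𝕜) p δ η) := by
  intro g
  set F : ∀ k, linSpace 𝕜 p δ (η k) := fun k =>
    linComb p δ (η k) fun i => coef 𝕜 p δ i fun j => g (blockStart η k + j) with hF
  have hcoef : ∀ k i, coef 𝕜 p δ i ((F k : ell 𝕜 p) : ℕ → 𝕜) =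
      if i < η k then coef 𝕜 p δ i (fun j => g (blockStart η k + j)) else 0 := fun k i =>
    coef_linComb hδ _ _ _
  have happ : ∀ k, ∀ j < (η k : ℕ), (F k : ell 𝕜 p) j = g (blockStart η k + j) := fun k =>
    apply_congr_of_coef (p := p) hδ fun j hj => by rw [hcoef, if_pos hj]
  have hs : Summable fun x : Σ k, Fin (η k) => ‖g (blockEquiv η x)‖ ^ p :=
    (blockEquiv η).summable_iff (f := fun n => ‖g n‖ ^ p).2 (summable_norm_rpow hp.out g)
  have hs2 := ((summable_sigma_of_nonneg fun x => Real.rpow_nonneg (norm_nonneg _) _).1 hs).2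
  have hmem : F ∈ lpSum p 𝕜 fun k => linSpace 𝕜 p δ (η k) := by
    refine Summable.of_nonneg_of_le (fun k => (ell.isPNorm 𝕜 p).rpow_nonneg (F k : ell 𝕜 p))
      (fun k => ?_) (hs2.mul_left 2)
    refine (norm_rpow_le_two_mul_sum hp.out hp1.out hδ (N := η k) (x := (F k : ell 𝕜 p))
      fun i hi => coef_eq_zero_of_mem hδ (F k).2 hi).trans (le_of_eq ?_)
    rw [tsum_fintype, ← Fin.sum_univ_eq_sum_range (fun i => ‖(F k : ell 𝕜 p) i‖ ^ p)]
    congr 1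
    exact Finset.sum_congr rfl fun i _ => by rw [happ k i i.isLt]; rfl
  refine ⟨⟨F, hmem⟩, lp.ext (funext fun n => ?_)⟩
  have h := happ (block η n) (blockPos η n) (blockPos η n).isLt
  rw [blockStart_add_blockPos] at h
  exact h

theorem isomorphic_ell (hδ : ∀ n, 2 ≤ δ n) : Isomorphic 𝕜 (YSpace 𝕜 p δ η) (ell 𝕜 p) := by
  have hY := lpSum.isPNorm p 𝕜 fun k => linSpace 𝕜 p δ (η k)
  have hE := ell.isPNorm 𝕜 p
  have h2 : (1 : ℝ) ≤ 2 ^ (1 / p) := Real.one_le_rpow one_le_two (by have := hp.out; positivity)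
  refine ⟨LinearEquiv.ofBijective (toEll p δ η) ⟨toEll_injective hδ, toEll_surjective hδ⟩,
    2 ^ (1 / p), fun f => ?_, fun g => ?_⟩
  · have h1 : ‖toEll p δ η f‖ ≤ ‖f‖ :=
      (Real.rpow_le_rpow_iff (hE.nonneg _) (hY.nonneg f) hp.out).1 (norm_toEll_rpow_le f)
    exact h1.trans (le_mul_of_one_le_left (hY.nonneg f) h2)
  · obtain ⟨f, rfl⟩ := toEll_surjective (𝕜 := 𝕜) (p := p) (η := η) hδ g
    have h3 : (LinearEquiv.ofBijective (toEll p δ η)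
        ⟨toEll_injective hδ, toEll_surjective hδ⟩).symm (toEll p δ η f) = f :=
      LinearEquiv.ofBijective_symm_apply_apply _ _
    rw [h3, ← Real.rpow_le_rpow_iff (hY.nonneg f)
      (mul_nonneg (by linarith) (hE.nonneg _)) hp.out, Real.mul_rpow (by linarith) (hE.nonneg _),
      ← Real.rpow_mul zero_le_two, one_div_mul_cancel hp.out.ne', Real.rpow_one]
    exact le_norm_toEll_rpow hδ f

/-! ### Convergence of the expansions -/

theorem component_sub (f g : YSpace 𝕜 p δ η) (k : ℕ) :
    component (f - g) k = component f k - component g k := rfl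

theorem tendsto_sub_coordProj (hδ : ∀ n, 2 ≤ δ n) (f : YSpace 𝕜 p δ η) :
    Filter.Tendsto (fun N => ‖f - coordProj (yBasis 𝕜 p δ η) (yCoef 𝕜 p δ η)
      (Finset.range N) f‖) Filter.atTop (𝓝 0) := by
  have hY := lpSum.isPNorm p 𝕜 fun k => linSpace 𝕜 p δ (η k)
  have hE := ell.isPNorm 𝕜 p
  set S := fun N => coordProj (yBasis 𝕜 p δ η) (yCoef 𝕜 p δ η) (Finset.range N) f with hS
  have h1 : ∀ N k, ‖component (f - S N) k‖ ^ p ≤ 3 * ‖component f k‖ ^ p := fun N k => by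
    have h2 : ‖component (S N) k‖ ^ p ≤ 2 * ‖component f k‖ ^ p := by
      refine norm_rpow_truncate_le hp.out hp1.out hδ (M := N - blockStart η k) fun i => ?_
      rw [hS, coef_component_coordProj hδ]
      rcases lt_or_ge i (η k : ℕ) with hi | hi
      · have : i ∈ blockSet η (Finset.range N) k ↔ i < N - blockStart η k := by
          rw [mem_blockSet, Finset.mem_range]; omega
        simp only [this]
      · rw [coef_component_eq_zero hδ f hi, ite_self, ite_self]
    have h3 := hE.sub_rpow_le (component f k) (component (S N) k)
    rw [component_sub]
    linarith
  -- The error vanishes on the blocks that are exhausted, and on the others it is dominated by `f`.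
  have h0 : ∀ k, Filter.Tendsto (fun N => ‖component (f - S N) k‖ ^ p) Filter.atTop (𝓝 0) := by
    intro k
    refine tendsto_const_nhds.congr' ?_
    filter_upwards [Filter.eventually_ge_atTop (blockStart η (k + 1))] with N hN
    have h2 : component f k = component (S N) k := ext_coef hδ fun i => by
      rw [hS, coef_component_coordProj hδ]
      rcases lt_or_ge i (η k : ℕ) with hi | hi
      · rw [blockStart_succ] at hN
        rw [if_pos (mem_blockSet.2 ⟨hi, Finset.mem_range.2 (by omega)⟩)]
      · rw [coef_component_eq_zero hδ f hi, ite_self]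
    rw [component_sub, h2, sub_self, hE.zero_rpow]
  have h2 : Filter.Tendsto (fun N => ∑' k, ‖component (f - S N) k‖ ^ p) Filter.atTop
      (𝓝 (∑' _k : ℕ, (0 : ℝ))) := by
    refine tendsto_tsum_of_dominated_convergence ((summable_component f).mul_left 3) h0 ?_
    refine Filter.Eventually.of_forall fun N k => ?_
    rw [Real.norm_of_nonneg (component_rpow_nonneg _ _)]
    exact h1 N k
  rw [tsum_zero] at h2
  have h3 := h2.rpow_const (p := 1 / p) (Or.inr (by have := hp.out; positivity))
  rw [Real.zero_rpow (by have := hp.out; positivity)] at h3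
  refine h3.congr fun N => ?_
  rw [← norm_rpow_eq_tsum_component, ← Real.rpow_mul (hY.nonneg _), mul_one_div_cancel hp.out.ne',
    Real.rpow_one]

theorem isSchauderBasis_yBasis (hδ : ∀ n, 2 ≤ δ n) :
    IsSchauderBasis 𝕜 (yBasis 𝕜 p δ η) := by
  intro f
  refine ⟨fun n => yCoef 𝕜 p δ η n f, ?_, fun a ha => funext fun j => ?_⟩
  · have := tendsto_sub_coordProj hδ f
    simpa only [coordProj_apply] using this
  · have h1 : ∀ᶠ N in Filter.atTop, ‖yCoef 𝕜 p δ η j f - a j‖ ≤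
        ‖f - ∑ n ∈ Finset.range N, a n • yBasis 𝕜 p δ η n‖ := by
      filter_upwards [Filter.eventually_gt_atTop j] with N hN
      refine le_trans (le_of_eq ?_) (norm_yCoef_le hδ j _)
      rw [map_sub, yCoef_sum hδ, if_pos (Finset.mem_range.2 hN)]
    have h2 := ge_of_tendsto ha h1
    exact (sub_eq_zero.1 (norm_le_zero_iff.1 h2)).symm

theorem isMBasis_yBasis (hδ : ∀ n, 2 ≤ δ n) :
    IsMBasis (yBasis 𝕜 p δ η) (yCoef 𝕜 p δ η) where
  biorthogonal := yCoef_yBasis hδ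
  fundamental f ε hε := by
    obtain ⟨N, hN⟩ := ((tendsto_sub_coordProj hδ f).eventually (gt_mem_nhds hε)).exists
    refine ⟨_, ?_, hN⟩
    rw [coordProj_apply]
    exact Submodule.sum_mem _ fun n _ => Submodule.smul_mem _ _ (Submodule.subset_span ⟨n, rfl⟩)
  total f hf := ext_yCoef hδ fun n => by rw [hf, map_zero]
  semi_normalized := by
    have hY := lpSum.isPNorm p 𝕜 fun k => linSpace 𝕜 p δ (η k)
    have h : ∀ n, ‖yBasis 𝕜 p δ η n‖ = 2 ^ (1 / p) := fun n => by
      rw [← norm_yBasis_rpow (𝕜 := 𝕜) (p := p) (η := η) hδ n, ← Real.rpow_mul (hY.nonneg _),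
        mul_one_div_cancel hp.out.ne', Real.rpow_one]
    exact ⟨2 ^ (1 / p), 2 ^ (1 / p), by positivity, fun n => ⟨(h n).ge, (h n).le⟩⟩
  bounded := ⟨1, fun n f => by rw [one_mul]; exact norm_yCoef_le hδ n f⟩

end YSpace

/-! ### Bounds for the constants of a basis -/

section Constants

variable {𝕜 Y : Type*} [RCLike 𝕜] [AddCommGroup Y] [Module 𝕜 Y] [Norm Y]
  {y : ℕ → Y} {φ : ℕ → Y →ₗ[𝕜] 𝕜}

theorem lebesgueConst_le {G : ℕ → Y → Finset ℕ} {m : ℕ} {K : ℝ} (hK : 0 < K)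
    (h : ∀ (f : Y) (B : Finset ℕ) (a : ℕ → 𝕜), B.card = m →
      ‖f - coordProj y φ (G m f) f‖ ≤ K * ‖f - ∑ n ∈ B, a n • y n‖) :
    lebesgueConst y φ G m ≤ ENNReal.ofReal K := by
  refine sInf_le fun f => ?_
  rw [← ENNReal.div_le_iff' (by simpa using hK) ENNReal.ofReal_ne_top]
  refine le_iInf fun B => le_iInf fun hB => le_iInf fun a => ?_
  rw [ENNReal.div_le_iff' (by simpa using hK) ENNReal.ofReal_ne_top, ← ENNReal.ofReal_mul hK.le]
  exact ENNReal.ofReal_le_ofReal (h f B a hB)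

theorem le_lebesgueConst {G : ℕ → Y → Finset ℕ} {m : ℕ} {K M : ℝ} (hM : 0 < M)
    {f : Y} {B : Finset ℕ} {a : ℕ → 𝕜} (hB : B.card = m) (h1 : ‖f - ∑ n ∈ B, a n • y n‖ ≤ M)
    (h2 : M * K ≤ ‖f - coordProj y φ (G m f) f‖) :
    ENNReal.ofReal K ≤ lebesgueConst y φ G m := by
  refine le_sInf fun C hC => ?_
  have h3 : bestApprox 𝕜 y m f ≤ ENNReal.ofReal M :=
    (iInf_le_of_le B <| iInf_le_of_le hB <| iInf_le _ a).trans (ENNReal.ofReal_le_ofReal h1)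
  have h4 : ENNReal.ofReal M * ENNReal.ofReal K ≤ ENNReal.ofReal M * C := by
    rw [← ENNReal.ofReal_mul hM.le]
    exact (ENNReal.ofReal_le_ofReal h2).trans ((hC f).trans
      ((mul_le_mul_right h3 C).trans_eq (mul_comm _ _)))
  exact (ENNReal.mul_le_mul_iff_right (by simpa using hM) ENNReal.ofReal_ne_top).1 h4

theorem condConst_le {m : ℕ} {K : ℝ} (hK : 0 ≤ K)
    (h : ∀ (A : Finset ℕ) (f : Y), A.card ≤ m → ‖coordProj y φ A f‖ ≤ K * ‖f‖) :
    condConst y φ m ≤ ENNReal.ofReal K :=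
  iSup_le fun A => iSup_le fun hA => iSup_le fun f => iSup_le fun hf =>
    ENNReal.ofReal_le_ofReal ((h A f hA).trans (mul_le_of_le_one_right hK hf))

variable {p : ℝ}

theorem le_condConst (hY : IsPNorm p 𝕜 Y) {m : ℕ} {K M : ℝ} (hM : 0 < M) {A : Finset ℕ} {f : Y}
    (hA : A.card ≤ m) (h1 : ‖f‖ ≤ M) (h2 : M * K ≤ ‖coordProj y φ A f‖) :
    ENNReal.ofReal K ≤ condConst y φ m := by
  have hn : ‖((M⁻¹ : ℝ) : 𝕜)‖ = M⁻¹ := by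
    rw [RCLike.norm_ofReal, abs_of_pos (inv_pos.2 hM)]
  refine le_iSup_of_le A <| le_iSup_of_le hA <| le_iSup_of_le (((M⁻¹ : ℝ) : 𝕜) • f) <|
    le_iSup_of_le ?_ (ENNReal.ofReal_le_ofReal ?_)
  · rw [hY.smul, hn, inv_mul_le_iff₀ hM, mul_one]
    exact h1
  · rw [map_smul, hY.smul, hn, le_inv_mul_iff₀ hM]
    exact h2

theorem le_condConstInit (hY : IsPNorm p 𝕜 Y) {m : ℕ} {K M : ℝ} (hM : 0 < M) {A : Finset ℕ} {f : Y}
    (hf : f ∈ Submodule.span 𝕜 (y '' Set.Iio m)) (h1 : ‖f‖ ≤ M)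
    (h2 : M * K ≤ ‖coordProj y φ A f‖) : ENNReal.ofReal K ≤ condConstInit y φ m := by
  have hn : ‖((M⁻¹ : ℝ) : 𝕜)‖ = M⁻¹ := by
    rw [RCLike.norm_ofReal, abs_of_pos (inv_pos.2 hM)]
  refine le_iSup_of_le A <| le_iSup_of_le (((M⁻¹ : ℝ) : 𝕜) • f) <|
    le_iSup_of_le (Submodule.smul_mem _ _ hf) <| le_iSup_of_le ?_ (ENNReal.ofReal_le_ofReal ?_)
  · rw [hY.smul, hn, inv_mul_le_iff₀ hM, mul_one]
    exact h1
  · rw [map_smul, hY.smul, hn, le_inv_mul_iff₀ hM]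
    exact h2

/-- On `[y_1, …, y_m]` only the coordinates below `m` matter. -/
theorem condConstInit_le_condConst (hbi : ∀ n k, φ n (y k) = if n = k then 1 else 0) (m : ℕ) :
    condConstInit y φ m ≤ condConst y φ m := by
  refine iSup_le fun A => iSup_le fun f => iSup_le fun hf => iSup_le fun hf1 => ?_
  have h0 : ∀ n, m ≤ n → φ n f = 0 := fun n hn => by
    have h : Submodule.span 𝕜 (y '' Set.Iio m) ≤ LinearMap.ker (φ n) := by
      rw [Submodule.span_le]
      rintro _ ⟨k, hk, rfl⟩
      have : k < m := hk
      rw [SetLike.mem_coe, LinearMap.mem_ker, hbi, if_neg (by omega)]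
    exact h hf
  have h1 : coordProj y φ A f = coordProj y φ (A.filter (· < m)) f := by
    rw [coordProj_apply, coordProj_apply, Finset.sum_filter]
    refine Finset.sum_congr rfl fun n _ => ?_
    split_ifs with hn
    · rfl
    · rw [h0 n (not_lt.1 hn), zero_smul]
  rw [h1]
  refine le_iSup_of_le (A.filter (· < m)) <| le_iSup_of_le ?_ <| le_iSup_of_le f <|
    le_iSup_of_le hf1 le_rfl
  have h2 : A.filter (· < m) ⊆ Finset.range m := fun n hn =>
    Finset.mem_range.2 (Finset.mem_filter.1 hn).2
  simpa using Finset.card_le_card h2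

theorem rpow_one_div_le_of_le (hp0 : 0 < p) {x y : ℝ} (hx : 0 ≤ x) (hy : 0 ≤ y) (h : x ≤ y ^ p) :
    x ^ (1 / p) ≤ y := by
  have := Real.rpow_le_rpow hx h (by positivity : 0 ≤ 1 / p)
  rwa [← Real.rpow_mul hy, mul_one_div_cancel hp0.ne', Real.rpow_one] at this

theorem le_rpow_one_div_of_le (hp0 : 0 < p) {x y : ℝ} (hy : 0 ≤ y) (h : y ^ p ≤ x) :
    y ≤ x ^ (1 / p) := by
  have := Real.rpow_le_rpow (Real.rpow_nonneg hy p) h (by positivity : 0 ≤ 1 / p)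
  rwa [← Real.rpow_mul hy, mul_one_div_cancel hp0.ne', Real.rpow_one] at this

theorem toNNReal_mul_ofReal_rpow {c x : ℝ} (hc : 0 ≤ c) (hx : 0 ≤ x) :
    ((c ^ (1 / p)).toNNReal : ℝ≥0∞) * ENNReal.ofReal (x ^ (1 / p)) =
      ENNReal.ofReal ((c * x) ^ (1 / p)) := by
  rw [Real.mul_rpow hc hx, ENNReal.ofReal_mul (Real.rpow_nonneg hc _)]
  rfl

end Constants

section YSpace

variable {𝕜 : Type*} [RCLike 𝕜] {p : ℝ} [hp : Fact (0 < p)] [hp1 : Fact (p ≤ 1)] {δ : ℕ → ℕ}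
  {η : ℕ → ℕ+}

/-! ### Greedy sets, almost greediness, and the upper estimates -/

variable (𝕜 p δ η) in
/-- The coordinate projections of the basis of `Y`. -/
abbrev yProj (A : Finset ℕ) : YSpace 𝕜 p δ η →ₗ[𝕜] YSpace 𝕜 p δ η :=
  coordProj (yBasis 𝕜 p δ η) (yCoef 𝕜 p δ η) A

variable (𝕜 p δ η) in
theorem isPNorm_ySpace : IsPNorm p 𝕜 (YSpace 𝕜 p δ η) := lpSum.isPNorm p 𝕜 _

theorem norm_sum_smul_yBasis_le (hδ : ∀ n, 2 ≤ δ n) (A : Finset ℕ) (a : ℕ → 𝕜) :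
    ‖∑ n ∈ A, a n • yBasis 𝕜 p δ η n‖ ^ p ≤ 2 * ∑ n ∈ A, ‖a n‖ ^ p := by
  have hY := isPNorm_ySpace 𝕜 p δ η
  refine (hY.sum_rpow_le A _).trans (le_of_eq ?_)
  rw [Finset.mul_sum]
  refine Finset.sum_congr rfl fun n _ => ?_
  rw [hY.smul_rpow, norm_yBasis_rpow hδ, mul_comm]

theorem norm_yProj_le_sum (hδ : ∀ n, 2 ≤ δ n) (A : Finset ℕ) (f : YSpace 𝕜 p δ η) :
    ‖yProj 𝕜 p δ η A f‖ ^ p ≤ 2 * ∑ n ∈ A, ‖yCoef 𝕜 p δ η n f‖ ^ p := by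
  rw [coordProj_apply]
  exact norm_sum_smul_yBasis_le hδ A _

theorem norm_yProj_le (hδ : ∀ n, 2 ≤ δ n) (hmono : Monotone δ) {m : ℕ} (hm : 2 ≤ m) {A : Finset ℕ}
    (hA : A.card ≤ m) (f : YSpace 𝕜 p δ η) :
    ‖yProj 𝕜 p δ η A f‖ ^ p ≤ 6 * Gamma δ m * ‖f‖ ^ p := by
  have hY := isPNorm_ySpace 𝕜 p δ η
  have h1 := norm_yProj_le_sum hδ A f
  have h2 := sum_norm_yCoef_le hδ hmono f (hA.trans (le_levelStart_Gamma_succ hδ m))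
  have h3 : (1 : ℝ) ≤ Gamma δ m := by exact_mod_cast one_le_Gamma hm
  have h4 := hY.rpow_nonneg f
  push_cast at h2
  nlinarith

theorem exists_threshold (hδ : ∀ n, 2 ≤ δ n) {f : YSpace 𝕜 p δ η} {A : Finset ℕ}
    (hA : IsGreedySet (yCoef 𝕜 p δ η) f A) :
    ∃ τ : ℝ, 0 ≤ τ ∧ (∀ n ∈ A, τ ≤ ‖yCoef 𝕜 p δ η n f‖ ^ p) ∧
      ∀ n ∉ A, ‖yCoef 𝕜 p δ η n f‖ ^ p ≤ τ := by
  rcases A.eq_empty_or_nonempty with rfl | hne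
  · exact ⟨‖f‖ ^ p, (isPNorm_ySpace 𝕜 p δ η).rpow_nonneg f, by simp,
      fun n _ => norm_yCoef_rpow_le hδ n f⟩
  · obtain ⟨k, hk, hmin⟩ := A.exists_min_image (fun n => ‖yCoef 𝕜 p δ η n f‖ ^ p) hne
    exact ⟨_, Real.rpow_nonneg (norm_nonneg _) _, hmin, fun n hn =>
      Real.rpow_le_rpow (norm_nonneg _) (hA k hk n hn) hp.out.le⟩

theorem norm_yProj_greedy_le (hδ : ∀ n, 2 ≤ δ n) {f : YSpace 𝕜 p δ η} {A : Finset ℕ}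
    (hA : IsGreedySet (yCoef 𝕜 p δ η) f A) : ‖yProj 𝕜 p δ η A f‖ ^ p ≤ 10 * ‖f‖ ^ p := by
  obtain ⟨τ, hτ, h1, h2⟩ := exists_threshold hδ hA
  exact norm_coordProj_greedy_le hδ hτ h1 h2

/-- Coefficients of `f` on `Q` that are dominated by as many coefficients of `g` contribute at most
a constant times `‖g‖`. -/
theorem norm_yProj_le_of_dominated (hδ : ∀ n, 2 ≤ δ n) {f g : YSpace 𝕜 p δ η} {P Q : Finset ℕ}
    (hcard : Q.card ≤ P.card)
    (h : ∀ n ∈ P, ∀ k ∈ Q, ‖yCoef 𝕜 p δ η k f‖ ≤ ‖yCoef 𝕜 p δ η n g‖) :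
    ‖yProj 𝕜 p δ η Q f‖ ^ p ≤ 4 * ‖g‖ ^ p := by
  have h0 := norm_yProj_le_sum hδ Q f
  rcases Q.eq_empty_or_nonempty with rfl | hne
  · have := (isPNorm_ySpace 𝕜 p δ η).rpow_nonneg g
    rw [Finset.sum_empty] at h0
    linarith
  · obtain ⟨k, hk, hmax⟩ := Q.exists_max_image (fun n => ‖yCoef 𝕜 p δ η n f‖ ^ p) hne
    have hτ : 0 ≤ ‖yCoef 𝕜 p δ η k f‖ ^ p := Real.rpow_nonneg (norm_nonneg _) _
    have h1 := card_large_coef_le hδ (f := g) (A := P) hτ fun n hn =>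
      Real.rpow_le_rpow (norm_nonneg _) (h n hn k hk) hp.out.le
    have h2 := Finset.sum_le_card_nsmul Q _ _ hmax
    rw [nsmul_eq_mul] at h2
    have h3 : (Q.card : ℝ) ≤ P.card := by exact_mod_cast hcard
    have h4 := mul_le_mul_of_nonneg_right h3 hτ
    linarith

theorem card_sdiff_le_of_card_le {A B : Finset ℕ} (h : B.card ≤ A.card) :
    (B \ A).card ≤ (A \ B).card := by
  have h1 := Finset.card_sdiff_add_card_inter A B
  have h2 := Finset.card_sdiff_add_card_inter B A
  rw [Finset.inter_comm] at h2
  omega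

/-- With `g = f - S_B f`, the set `A \ B` is greedy for `g`, and
`f - S_A f = (g - S_{A \ B} g) + S_{B \ A} f`. -/
theorem isAlmostGreedy_yBasis (hδ : ∀ n, 2 ≤ δ n) :
    IsAlmostGreedy (yBasis 𝕜 p δ η) (yCoef 𝕜 p δ η) := by
  have hY := isPNorm_ySpace 𝕜 p δ η
  refine ⟨15 ^ (1 / p), fun f A B hA hcard => hY.le_of_rpow_le (by norm_num) ?_⟩
  set g := f - yProj 𝕜 p δ η B f with hg
  have hcoef : ∀ n, yCoef 𝕜 p δ η n g = if n ∈ B then 0 else yCoef 𝕜 p δ η n f := fun n => by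
    rw [hg, map_sub, yCoef_coordProj hδ]; split_ifs <;> simp
  have hgreedy : IsGreedySet (yCoef 𝕜 p δ η) g (A \ B) := by
    intro n hn k hk
    rw [Finset.mem_sdiff] at hn hk
    rw [hcoef, hcoef, if_neg hn.2]
    split_ifs with hkB
    · simp
    · exact hA n hn.1 k fun hkA => hk ⟨hkA, hkB⟩
  have hdec : f - yProj 𝕜 p δ η A f =
      (g - yProj 𝕜 p δ η (A \ B) g) + yProj 𝕜 p δ η (B \ A) f := by
    refine ext_yCoef hδ fun n => ?_
    simp only [map_add, map_sub, yCoef_coordProj hδ, hcoef, Finset.mem_sdiff]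
    by_cases h1 : n ∈ A <;> by_cases h2 : n ∈ B <;> simp [h1, h2]
  have h1 := hY.triangle (g - yProj 𝕜 p δ η (A \ B) g) (yProj 𝕜 p δ η (B \ A) f)
  have h2 := hY.sub_rpow_le g (yProj 𝕜 p δ η (A \ B) g)
  have h3 := norm_yProj_greedy_le hδ hgreedy
  have h4 := norm_yProj_le_of_dominated hδ (f := f) (g := g) (card_sdiff_le_of_card_le hcard)
    fun n hn k hk => by
      rw [Finset.mem_sdiff] at hn hk
      rw [hcoef, if_neg hn.2]
      exact hA n hn.1 k hk.2
  rw [← hdec] at h1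
  linarith

/-- With `g = f - z`, where `z` is a combination of the basis vectors in `B`,
`f - S_A f = g - S_{A ∪ B} g + S_{B \ A} f`. -/
theorem norm_sub_yProj_le (hδ : ∀ n, 2 ≤ δ n) (hmono : Monotone δ) {m : ℕ} (hm : 2 ≤ m)
    {f : YSpace 𝕜 p δ η} {A B : Finset ℕ} (a : ℕ → 𝕜) (hA : IsGreedySet (yCoef 𝕜 p δ η) f A)
    (hAm : A.card = m) (hBm : B.card = m) :
    ‖f - yProj 𝕜 p δ η A f‖ ^ p ≤
      17 * Gamma δ m * ‖f - ∑ n ∈ B, a n • yBasis 𝕜 p δ η n‖ ^ p := by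
  have hY := isPNorm_ySpace 𝕜 p δ η
  set g := f - ∑ n ∈ B, a n • yBasis 𝕜 p δ η n with hg
  have hcoef : ∀ n ∉ B, yCoef 𝕜 p δ η n g = yCoef 𝕜 p δ η n f := fun n hn => by
    rw [hg, map_sub, yCoef_sum hδ, if_neg hn, sub_zero]
  have hdec : f - yProj 𝕜 p δ η A f =
      (g - (yProj 𝕜 p δ η A g + yProj 𝕜 p δ η (B \ A) g)) + yProj 𝕜 p δ η (B \ A) f := by
    refine ext_yCoef hδ fun n => ?_
    simp only [map_add, map_sub, yCoef_coordProj hδ, Finset.mem_sdiff]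
    by_cases h1 : n ∈ A <;> by_cases h2 : n ∈ B <;> simp [h1, h2, hcoef]
  have h1 := hY.triangle (g - (yProj 𝕜 p δ η A g + yProj 𝕜 p δ η (B \ A) g))
    (yProj 𝕜 p δ η (B \ A) f)
  have h2 := hY.sub_rpow_le g (yProj 𝕜 p δ η A g + yProj 𝕜 p δ η (B \ A) g)
  have h3 := hY.triangle (yProj 𝕜 p δ η A g) (yProj 𝕜 p δ η (B \ A) g)
  have h4 := norm_yProj_le hδ hmono hm hAm.le g
  have h5 := norm_yProj_le hδ hmono hm
    ((Finset.card_le_card (Finset.sdiff_subset (s := B) (t := A))).trans hBm.le) g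
  have h6 := norm_yProj_le_of_dominated hδ (f := f) (g := g)
    (card_sdiff_le_of_card_le (hBm.trans hAm.symm).le) fun n hn k hk => by
      rw [Finset.mem_sdiff] at hn hk
      rw [hcoef n hn.2]
      exact hA n hn.1 k hk.2
  have h7 : (1 : ℝ) ≤ Gamma δ m := by exact_mod_cast one_le_Gamma hm
  have h8 := hY.rpow_nonneg g
  rw [← hdec] at h1
  nlinarith

theorem exists_isGreedyChoice (hδ : ∀ n, 2 ≤ δ n) :
    ∃ G, IsGreedyChoice (yCoef 𝕜 p δ η) G := by
  have key : ∀ m (f : YSpace 𝕜 p δ η), ∃ A : Finset ℕ, A.card = m ∧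
      IsGreedySet (yCoef 𝕜 p δ η) f A := by
    intro m f
    induction m with
    | zero => exact ⟨∅, rfl, fun n hn => absurd hn (Finset.notMem_empty n)⟩
    | succ m ih =>
      obtain ⟨A, hAm, hA⟩ := ih
      -- The next index carries the largest of the remaining coefficients.
      obtain ⟨n, hn, hmax⟩ : ∃ n ∉ A, ∀ k ∉ A, ‖yCoef 𝕜 p δ η k f‖ ≤ ‖yCoef 𝕜 p δ η n f‖ := by
        by_cases h : ∃ n ∉ A, yCoef 𝕜 p δ η n f ≠ 0
        · obtain ⟨n, hn, hne⟩ := h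
          set τ := ‖yCoef 𝕜 p δ η n f‖ ^ p with hτ
          have hτ0 : 0 < τ := Real.rpow_pos_of_pos (norm_pos_iff.2 hne) p
          have hfin : {k | τ ≤ ‖yCoef 𝕜 p δ η k f‖ ^ p}.Finite := by
            by_contra hinf
            obtain ⟨M, hM⟩ := exists_nat_gt (2 * ‖f‖ ^ p / τ)
            obtain ⟨T, hT, hTM⟩ := Set.Infinite.exists_subset_card_eq hinf M
            have h1 := card_large_coef_le hδ (f := f) (A := T) hτ0.le fun k hk => hT hk
            rw [hTM] at h1
            rw [div_lt_iff₀ hτ0] at hM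
            linarith
          obtain ⟨k, hk, hkmax⟩ := (hfin.toFinset \ A).exists_max_image
            (fun k => ‖yCoef 𝕜 p δ η k f‖) ⟨n, by simp [hn, hτ]⟩
          rw [Finset.mem_sdiff] at hk
          refine ⟨k, hk.2, fun i hi => ?_⟩
          by_cases hiτ : τ ≤ ‖yCoef 𝕜 p δ η i f‖ ^ p
          · exact hkmax i (by simp [hi, hiτ])
          · have h1 : τ ≤ ‖yCoef 𝕜 p δ η k f‖ ^ p := by simpa using hk.1
            exact (Real.rpow_le_rpow_iff (norm_nonneg _) (norm_nonneg _) hp.out).1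
              ((not_le.1 hiτ).le.trans h1)
        · push Not at h
          obtain ⟨n, hn⟩ := Infinite.exists_notMem_finset A
          exact ⟨n, hn, fun k hk => by rw [h k hk, h n hn]⟩
      refine ⟨insert n A, by rw [Finset.card_insert_of_notMem hn, hAm], fun i hi k hk => ?_⟩
      rw [Finset.mem_insert, not_or] at hk
      rcases Finset.mem_insert.1 hi with rfl | hi
      · exact hmax k hk.2
      · exact hA i hi k hk.2
  choose G hG using key
  exact ⟨G, hG⟩

/-! ### Test vectors for the lower estimates -/

/-- The expansion of `e_0` truncated to the first `n` levels, placed in the block `k`. -/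
def rootVec (p : ℝ) [Fact (0 < p)] [Fact (p ≤ 1)] (δ : ℕ → ℕ) (η : ℕ → ℕ+) (k n : ℕ) :
    YSpace 𝕜 p δ η :=
  ∑ m ∈ Finset.Ico (blockStart η k) (blockStart η k + levelStart δ n),
    rootCoef 𝕜 p δ (m - blockStart η k) • yBasis 𝕜 p δ η m

theorem yCoef_rootVec (hδ : ∀ n, 2 ≤ δ n) (k n m : ℕ) :
    yCoef 𝕜 p δ η m (rootVec p δ η k n) =
      if m ∈ Finset.Ico (blockStart η k) (blockStart η k + levelStart δ n) then
        rootCoef 𝕜 p δ (m - blockStart η k) else 0 :=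
  yCoef_sum hδ _ _ _

theorem norm_yCoef_rootVec_le (hδ : ∀ n, 2 ≤ δ n) (k n m : ℕ) :
    ‖yCoef 𝕜 p δ η m (rootVec p δ η k n)‖ ≤ 1 := by
  rw [yCoef_rootVec hδ]
  split_ifs
  · exact norm_rootCoef_le hp.out hδ _
  · simp

theorem norm_rootVec_rpow_le (hδ : ∀ n, 2 ≤ δ n) {k n : ℕ} (hk : levelStart δ n ≤ η k) :
    ‖(rootVec p δ η k n : YSpace 𝕜 p δ η)‖ ^ p ≤ 2 := by
  have hcoef : ∀ j i, coef 𝕜 p δ i (component (rootVec p δ η k n : YSpace 𝕜 p δ η) j) =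
      if j = k ∧ i < levelStart δ n then rootCoef 𝕜 p δ i else 0 := by
    intro j i
    rcases lt_or_ge i (η j : ℕ) with hi | hi
    · rw [← yCoef_add hi, yCoef_rootVec hδ]
      by_cases hjk : j = k
      · subst hjk
        simp
      · have h0 : blockStart η j + i ∉
            Finset.Ico (blockStart η k) (blockStart η k + levelStart δ n) := fun h => by
          rw [Finset.mem_Ico] at h
          have h1 := block_add (η := η) (k := k) (i := blockStart η j + i - blockStart η k)
            (by omega)
          rw [Nat.add_sub_cancel' h.1, block_add hi] at h1
          exact hjk h1
        rw [if_neg h0, if_neg fun h => hjk h.1]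
    · rw [coef_component_eq_zero hδ _ hi, if_neg]
      rintro ⟨rfl, h⟩
      omega
  rw [norm_rpow_eq_tsum_component, tsum_eq_single k]
  · exact norm_root_truncate_le hp.out hp1.out hδ (M := levelStart δ n) fun i => by
      rw [hcoef]; simp
  · intro j hj
    have h0 : component (rootVec p δ η k n : YSpace 𝕜 p δ η) j = 0 := ext_coef hδ fun i => by
      rw [hcoef, if_neg fun h => hj h.1, lp.coeFn_zero, map_zero]
    rw [h0, (ell.isPNorm 𝕜 p).zero_rpow]

theorem le_norm_of_even (hδ : ∀ n, 2 ≤ δ n) {k n : ℕ} (hk : levelStart δ n ≤ η k)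
    {f : YSpace 𝕜 p δ η} (hf : ∀ i < levelStart δ n, yCoef 𝕜 p δ η (blockStart η k + i) f =
      if Even (depth δ i) then rootCoef 𝕜 p δ i else 0) : (n : ℝ) ≤ ‖f‖ ^ p := by
  refine le_trans (le_norm_root_even hp.out hδ fun i hi => ?_) (norm_component_rpow_le f k)
  rw [← yCoef_add (hi.trans_le hk), hf i hi]

/-- The indices in the first `n` levels of the block `k` that have even depth. -/
def evenSet (δ : ℕ → ℕ) (η : ℕ → ℕ+) (k n : ℕ) : Finset ℕ :=
  {m ∈ Finset.Ico (blockStart η k) (blockStart η k + levelStart δ n) |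
    Even (depth δ (m - blockStart η k))}

theorem le_norm_yProj_evenSet (hδ : ∀ n, 2 ≤ δ n) {k n : ℕ} (hk : levelStart δ n ≤ η k) :
    (n : ℝ) ≤ ‖yProj 𝕜 p δ η (evenSet δ η k n) (rootVec p δ η k n)‖ ^ p := by
  refine le_norm_of_even hδ hk fun i hi => ?_
  rw [yCoef_coordProj hδ, yCoef_rootVec hδ, evenSet]
  simp [hi]

theorem card_evenSet_le (k n : ℕ) : (evenSet δ η k n).card ≤ levelStart δ n :=
  (Finset.card_filter_le _ _).trans (by simp)

/-- The vector `f = ∑_{n ∈ B} 2 y_n + (even part of the test vector)`, where `B` contains the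
indices of odd depth: its greedy set of cardinality `|B|` is `B`, and what remains is the even part,
while some other combination of the `y_n`, `n ∈ B`, turns `f` into the whole test vector. -/
theorem exists_bad_greedy (hδ : ∀ n, 2 ≤ δ n) {k n m : ℕ} (hk : levelStart δ n ≤ η k)
    (hm : levelStart δ n ≤ m) {G : ℕ → YSpace 𝕜 p δ η → Finset ℕ}
    (hG : IsGreedyChoice (yCoef 𝕜 p δ η) G) :
    ∃ (f : YSpace 𝕜 p δ η) (B : Finset ℕ) (a : ℕ → 𝕜), B.card = m ∧
      ‖f - ∑ i ∈ B, a i • yBasis 𝕜 p δ η i‖ ^ p ≤ 2 ∧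
      (n : ℝ) ≤ ‖f - yProj 𝕜 p δ η (G m f) f‖ ^ p := by
  set I := Finset.Ico (blockStart η k) (blockStart η k + levelStart δ n) with hI
  set O := I.filter fun i => ¬ Even (depth δ (i - blockStart η k)) with hO
  have hOcard : O.card ≤ levelStart δ n := (Finset.card_filter_le _ _).trans (by simp [hI])
  -- `X` only serves to adjust the cardinality.
  set X := Finset.Ico (blockStart η k + levelStart δ n)
    (blockStart η k + levelStart δ n + (m - O.card)) with hX
  have hdisj : Disjoint O X := by
    rw [Finset.disjoint_left]
    intro i hi hiX
    have h1 := (Finset.mem_Ico.1 (Finset.mem_filter.1 hi).1).2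
    have h2 := (Finset.mem_Ico.1 hiX).1
    omega
  set B := O ∪ X with hB
  have hBm : B.card = m := by
    rw [hB, Finset.card_union_of_disjoint hdisj, hX, Nat.card_Ico]
    omega
  set t : YSpace 𝕜 p δ η := rootVec p δ η k n with ht
  set a : ℕ → 𝕜 := fun i => 2 - yCoef 𝕜 p δ η i t with ha
  set f := t + ∑ i ∈ B, a i • yBasis 𝕜 p δ η i with hf
  have hcoef : ∀ i, yCoef 𝕜 p δ η i f = if i ∈ B then 2 else yCoef 𝕜 p δ η i t := fun i => by
    rw [hf, map_add, yCoef_sum hδ, ha]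
    split_ifs <;> ring
  have hGB : G m f = B := by
    obtain ⟨hc, hgr⟩ := hG m f
    refine (Finset.eq_of_subset_of_card_le (fun i hi => ?_) (by rw [hc, hBm])).symm
    by_contra hiG
    have hne : ¬ G m f ⊆ B := fun hsub => hiG <| by
      rw [Finset.eq_of_subset_of_card_le hsub (by rw [hc, hBm])]
      exact hi
    obtain ⟨j, hj, hjB⟩ := Finset.not_subset.1 hne
    have h1 := hgr j hj i hiG
    rw [hcoef, hcoef, if_pos hi, if_neg hjB] at h1
    have h2 := norm_yCoef_rootVec_le (𝕜 := 𝕜) (p := p) (η := η) hδ k n j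
    rw [RCLike.norm_ofNat] at h1
    linarith
  refine ⟨f, B, a, hBm, ?_, ?_⟩
  · rw [hf, add_sub_cancel_right]
    exact norm_rootVec_rpow_le hδ hk
  · refine le_norm_of_even hδ hk fun i hi => ?_
    have hmem : blockStart η k + i ∈ B ↔ ¬ Even (depth δ i) := by
      rw [hB, Finset.mem_union, hO, Finset.mem_filter, Nat.add_sub_cancel_left, hX, hI,
        Finset.mem_Ico, Finset.mem_Ico]
      constructor
      · rintro (h | h)
        · exact h.2
        · omega
      · exact fun h => Or.inl ⟨by omega, h⟩
    rw [hGB, map_sub, yCoef_coordProj hδ, hcoef, ht, yCoef_rootVec hδ]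
    by_cases hev : Even (depth δ i) <;> simp [hmem, hi, hev]

/-! ### Estimates for the constants of the basis of `Y` -/

theorem exists_le_of_not_bddAbove (hη : ¬ BddAbove (Set.range η)) (N : ℕ) : ∃ k, N ≤ η k := by
  by_contra! h
  refine hη ⟨⟨N + 1, N.succ_pos⟩, ?_⟩
  rintro _ ⟨k, rfl⟩
  have := h k
  show (η k : ℕ) ≤ N + 1
  omega

theorem lebesgueConst_yBasis (hδ : ∀ n, 2 ≤ δ n) (hmono : Monotone δ)
    (hη : ¬ BddAbove (Set.range η)) {G : ℕ → YSpace 𝕜 p δ η → Finset ℕ}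
    (hG : IsGreedyChoice (yCoef 𝕜 p δ η) G) {m : ℕ} (hm : 2 ≤ m) :
    ENNReal.ofReal ((1 / 2 * Gamma δ m) ^ (1 / p)) ≤
        lebesgueConst (yBasis 𝕜 p δ η) (yCoef 𝕜 p δ η) G m ∧
      lebesgueConst (yBasis 𝕜 p δ η) (yCoef 𝕜 p δ η) G m ≤
        ENNReal.ofReal ((17 * Gamma δ m) ^ (1 / p)) := by
  have hY := isPNorm_ySpace 𝕜 p δ η
  have hp0 := hp.out
  have h1 : (1 : ℝ) ≤ Gamma δ m := by exact_mod_cast one_le_Gamma hm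
  constructor
  · obtain ⟨k, hk⟩ := exists_le_of_not_bddAbove hη (levelStart δ (Gamma δ m))
    obtain ⟨f, B, a, hB, h2, h3⟩ := exists_bad_greedy hδ hk (levelStart_Gamma_lt hm).le hG
    refine le_lebesgueConst (M := 2 ^ (1 / p)) (by positivity) hB
      (le_rpow_one_div_of_le hp0 (hY.nonneg _) h2) ?_
    rw [← Real.mul_rpow zero_le_two (by positivity), ← mul_assoc, mul_one_div_cancel two_ne_zero,
      one_mul]
    exact rpow_one_div_le_of_le hp0 (by positivity) (hY.nonneg _) h3
  · exact lebesgueConst_le (by positivity) fun f B a hB => hY.le_of_rpow_le (by positivity)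
      (norm_sub_yProj_le hδ hmono hm a (hG m f).2 (hG m f).1 hB)

theorem condConst_yBasis_le (hδ : ∀ n, 2 ≤ δ n) (hmono : Monotone δ) {m : ℕ} (hm : 2 ≤ m) :
    condConst (yBasis 𝕜 p δ η) (yCoef 𝕜 p δ η) m ≤
      ENNReal.ofReal ((6 * Gamma δ m) ^ (1 / p)) :=
  condConst_le (by positivity) fun _ f hA =>
    (isPNorm_ySpace 𝕜 p δ η).le_of_rpow_le (by positivity) (norm_yProj_le hδ hmono hm hA f)

theorem le_condConst_yBasis (hδ : ∀ n, 2 ≤ δ n) (hη : ¬ BddAbove (Set.range η)) {m : ℕ}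
    (hm : 2 ≤ m) : ENNReal.ofReal ((1 / 2 * Gamma δ m) ^ (1 / p)) ≤
      condConst (yBasis 𝕜 p δ η) (yCoef 𝕜 p δ η) m := by
  have hY := isPNorm_ySpace 𝕜 p δ η
  have hp0 := hp.out
  obtain ⟨k, hk⟩ := exists_le_of_not_bddAbove hη (levelStart δ (Gamma δ m))
  refine le_condConst hY (M := 2 ^ (1 / p)) (by positivity)
    ((card_evenSet_le (δ := δ) (η := η) k (Gamma δ m)).trans (levelStart_Gamma_lt hm).le)
    (le_rpow_one_div_of_le hp0 (hY.nonneg _) (norm_rootVec_rpow_le hδ hk)) ?_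
  rw [← Real.mul_rpow zero_le_two (by positivity), ← mul_assoc, mul_one_div_cancel two_ne_zero,
    one_mul]
  exact rpow_one_div_le_of_le hp0 (by positivity) (hY.nonneg _) (le_norm_yProj_evenSet hδ hk)

/-- If the block lengths grow geometrically, a fixed proportion of the first `m` vectors lies in one
block. -/
theorem exists_large_block {K : ℝ} (hK : ∀ k, ∑ j ∈ Finset.range k, (η j : ℝ) ≤ K * (η k : ℝ)) :
    ∃ q : ℕ, ∀ m : ℕ, ∃ k R : ℕ, R ≤ η k ∧ blockStart η k + R ≤ m ∧ m ≤ 2 ^ q * R := by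
  obtain ⟨c, hc⟩ := exists_nat_ge K
  have hstart : ∀ k, blockStart η k ≤ c * η k := fun k => by
    have h1 : (blockStart η k : ℝ) ≤ c * (η k : ℝ) := by
      rw [blockStart]; push_cast
      exact (hK k).trans (mul_le_mul_of_nonneg_right hc (Nat.cast_nonneg _))
    exact_mod_cast h1
  refine ⟨2 * (c + 1), fun m => ?_⟩
  have hq : 2 * (c + 1) ≤ 2 ^ (2 * (c + 1)) := Nat.lt_two_pow_self.le
  have h1 := blockStart_le η m
  have h2 := lt_blockStart η m
  rw [blockStart_succ] at h2
  by_cases h : m ≤ 2 * (m - blockStart η (block η m))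
  · refine ⟨block η m, m - blockStart η (block η m), by omega, by omega, h.trans ?_⟩
    exact Nat.mul_le_mul_right _ (by omega)
  · obtain ⟨k, hk⟩ : ∃ k, block η m = k + 1 := by
      refine Nat.exists_eq_succ_of_ne_zero fun h0 => h ?_
      rw [h0]
      simp [blockStart]
      omega
    rw [hk] at h h1
    have h3 := hstart k
    rw [blockStart_succ] at h h1
    refine ⟨k, η k, le_rfl, h1, ?_⟩
    calc m ≤ 2 * (blockStart η k + η k) := by omega
      _ ≤ 2 * (c + 1) * η k := by linarith
      _ ≤ 2 ^ (2 * (c + 1)) * η k := Nat.mul_le_mul_right _ hq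

theorem le_condConstInit_yBasis (hδ : ∀ n, 2 ≤ δ n) {K : ℝ}
    (hK : ∀ k, ∑ j ∈ Finset.range k, (η j : ℝ) ≤ K * (η k : ℝ)) :
    ∃ c : ℝ, 0 < c ∧ ∀ m, 2 ≤ m → ENNReal.ofReal ((c * Gamma δ m) ^ (1 / p)) ≤
      condConstInit (yBasis 𝕜 p δ η) (yCoef 𝕜 p δ η) m := by
  have hY := isPNorm_ySpace 𝕜 p δ η
  have hp0 := hp.out
  obtain ⟨q, hq⟩ := exists_large_block hK
  refine ⟨1 / (2 * (q + 1)), by positivity, fun m hm => ?_⟩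
  obtain ⟨k, R, hRk, hRm, hmR⟩ := hq m
  have hR : 1 ≤ R := by
    rcases Nat.eq_zero_or_pos R with rfl | h
    · omega
    · exact h
  -- The number of levels that fit into the block is comparable with `Γ(m)`.
  obtain ⟨n, hn, hnR⟩ : ∃ n : ℕ, Gamma δ m ≤ n * (q + 1) ∧ levelStart δ n ≤ R := by
    rcases le_or_gt (Gamma δ m) q with h | h
    · refine ⟨1, by omega, ?_⟩
      rw [levelStart_succ, levelStart_zero, sigma_zero]
      exact hR
    · refine ⟨Gamma δ m - q, ?_, ?_⟩
      · obtain ⟨n, hn⟩ := Nat.exists_eq_add_of_lt h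
        rw [hn, show q + n + 1 - q = n + 1 by omega]
        nlinarith
      · have h1 := two_pow_mul_levelStart_le hδ (Gamma δ m - q) q
        rw [Nat.sub_add_cancel h.le] at h1
        have h2 := levelStart_Gamma_lt (δ := δ) hm
        exact Nat.le_of_mul_le_mul_left (h1.trans (h2.le.trans hmR)) (by positivity)
  have hk := hnR.trans hRk
  refine le_condConstInit hY (M := 2 ^ (1 / p)) (A := evenSet δ η k n)
    (f := rootVec p δ η k n) (by positivity) ?_
    (le_rpow_one_div_of_le hp0 (hY.nonneg _) (norm_rootVec_rpow_le hδ hk)) ?_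
  · refine Submodule.sum_mem _ fun i hi => Submodule.smul_mem _ _ (Submodule.subset_span ⟨i, ?_, rfl⟩)
    have := (Finset.mem_Ico.1 hi).2
    exact Set.mem_Iio.2 (by omega)
  · rw [← Real.mul_rpow zero_le_two (by positivity)]
    refine rpow_one_div_le_of_le hp0 (by positivity) (hY.nonneg _)
      (le_trans ?_ (le_norm_yProj_evenSet hδ hk))
    have h1 : (Gamma δ m : ℝ) ≤ n * (q + 1) := by exact_mod_cast hn
    rw [← mul_assoc, mul_one_div, div_mul_eq_mul_div, div_le_iff₀ (by positivity)]
    linarith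

end YSpace

end LindenstraussBases

end

theorem mainTheorem11 (𝕜 : Type*) [RCLike 𝕜] (p : ℝ) [Fact (0 < p)] [Fact (p ≤ 1)]
    (δ : ℕ → ℕ) (hδ : ∀ n, 2 ≤ δ n) (hmono : Monotone δ)
    (η : ℕ → ℕ+) (hη : ¬ BddAbove (Set.range η)) :
    LindenstraussBases.Isomorphic 𝕜 (LindenstraussBases.YSpace 𝕜 p δ η)
      (LindenstraussBases.ell 𝕜 p) ∧
    LindenstraussBases.IsSchauderBasis 𝕜 (LindenstraussBases.yBasis 𝕜 p δ η) ∧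
    ∃ φ : ℕ → LindenstraussBases.YSpace 𝕜 p δ η →ₗ[𝕜] 𝕜,
      LindenstraussBases.IsMBasis (LindenstraussBases.yBasis 𝕜 p δ η) φ ∧
      LindenstraussBases.IsAlmostGreedy (LindenstraussBases.yBasis 𝕜 p δ η) φ ∧
      (∃ G, LindenstraussBases.IsGreedyChoice φ G) ∧
      (∃ c C : ℝ≥0, 0 < c ∧ ∀ G, LindenstraussBases.IsGreedyChoice φ G → ∀ m : ℕ, 2 ≤ m →
        c * ENNReal.ofReal ((LindenstraussBases.Gamma δ m : ℝ) ^ (1 / p)) ≤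
            LindenstraussBases.lebesgueConst (LindenstraussBases.yBasis 𝕜 p δ η) φ G m ∧
        LindenstraussBases.lebesgueConst (LindenstraussBases.yBasis 𝕜 p δ η) φ G m ≤
            C * ENNReal.ofReal ((LindenstraussBases.Gamma δ m : ℝ) ^ (1 / p))) ∧
      (∃ c C : ℝ≥0, 0 < c ∧ ∀ m : ℕ, 2 ≤ m →
        c * ENNReal.ofReal ((LindenstraussBases.Gamma δ m : ℝ) ^ (1 / p)) ≤
            LindenstraussBases.condConst (LindenstraussBases.yBasis 𝕜 p δ η) φ m ∧
        LindenstraussBases.condConst (LindenstraussBases.yBasis 𝕜 p δ η) φ m ≤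
            C * ENNReal.ofReal ((LindenstraussBases.Gamma δ m : ℝ) ^ (1 / p))) ∧
      ((∃ K : ℝ, ∀ k, ∑ j ∈ Finset.range k, (η j : ℝ) ≤ K * (η k : ℝ)) →
        ∃ c C : ℝ≥0, 0 < c ∧ ∀ m : ℕ, 2 ≤ m →
          c * ENNReal.ofReal ((LindenstraussBases.Gamma δ m : ℝ) ^ (1 / p)) ≤
              LindenstraussBases.condConstInit (LindenstraussBases.yBasis 𝕜 p δ η) φ m ∧
          LindenstraussBases.condConstInit (LindenstraussBases.yBasis 𝕜 p δ η) φ m ≤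
              C * ENNReal.ofReal ((LindenstraussBases.Gamma δ m : ℝ) ^ (1 / p))) := by
  have hp : 0 < p := Fact.out
  refine ⟨LindenstraussBases.isomorphic_ell hδ, LindenstraussBases.isSchauderBasis_yBasis hδ,
    LindenstraussBases.yCoef 𝕜 p δ η, LindenstraussBases.isMBasis_yBasis hδ,
    LindenstraussBases.isAlmostGreedy_yBasis hδ, LindenstraussBases.exists_isGreedyChoice hδ,
    ⟨Real.toNNReal ((1 / 2) ^ (1 / p)), Real.toNNReal (17 ^ (1 / p)), ?_, fun G hG m hm => ?_⟩,
    ⟨Real.toNNReal ((1 / 2) ^ (1 / p)), Real.toNNReal (6 ^ (1 / p)), ?_, fun m hm => ?_⟩, ?_⟩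
  · exact Real.toNNReal_pos.2 (by positivity)
  · rw [LindenstraussBases.toNNReal_mul_ofReal_rpow (by positivity) (by positivity),
      LindenstraussBases.toNNReal_mul_ofReal_rpow (by positivity) (by positivity)]
    exact LindenstraussBases.lebesgueConst_yBasis hδ hmono hη hG hm
  · exact Real.toNNReal_pos.2 (by positivity)
  · rw [LindenstraussBases.toNNReal_mul_ofReal_rpow (by positivity) (by positivity),
      LindenstraussBases.toNNReal_mul_ofReal_rpow (by positivity) (by positivity)]
    exact ⟨LindenstraussBases.le_condConst_yBasis hδ hη hm,
      LindenstraussBases.condConst_yBasis_le hδ hmono hm⟩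
  · rintro ⟨K, hK⟩
    obtain ⟨c, hc, h⟩ := LindenstraussBases.le_condConstInit_yBasis (𝕜 := 𝕜) (p := p) hδ hK
    refine ⟨Real.toNNReal (c ^ (1 / p)), Real.toNNReal (6 ^ (1 / p)),
      Real.toNNReal_pos.2 (by positivity), fun m hm => ?_⟩
    rw [LindenstraussBases.toNNReal_mul_ofReal_rpow hc.le (by positivity),
      LindenstraussBases.toNNReal_mul_ofReal_rpow (by positivity) (by positivity)]
    exact ⟨h m hm, (LindenstraussBases.condConstInit_le_condConst
      (LindenstraussBases.yCoef_yBasis hδ) m).trans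
        (LindenstraussBases.condConst_yBasis_le hδ hmono hm)⟩
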